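/- **Setting.** Let $(\mathcal A,\tau)$ be a non-commutative probability space: $\mathcal A$ is a unital $*$-algebra over $\mathbb C$ and $\tau:\mathcal A\to\mathbb C$ is linear with $\tau(1)=1$. Let $\omega$ be a tracial weight on $\mathcal A$: a linear functional $\omega:D(\omega)\to\mathbb C$ on a (not necessarily unital) $*$-subalgebra $D(\omega)\subseteq\mathcal A$ with $\omega(ab)=\omega(ba)$, $\omega(a^*)=\overline{\omega(a)}$ and $\omega(a^*a)\ge 0$ for all $a,b\in D(\omega)$. On $M_n(\mathcal A)$ we use the tracial weight $\operatorname{Tr}_n\otimes\,\omega$, with domain $M_n(D(\omega))$ and $(\operatorname{Tr}_n\otimes\,\omega)(M)=\sum_i\omega(M_{ii})$. *Trace class families and eigenvalues.* Two families $(a_i)_{i\in I}$, $(b_i)_{i\in I}$ in the domains of tracial weights $\omega,\psi$ have the same distribution if $\omega(a_{i_1}^{\epsilon_1}\cdots a_{i_m}^{\epsilon_m})=\psi(b_{i_1}^{\epsilon_1}\cdots b_{i_m}^{\epsilon_m})$ for all $m\ge1$, $i_1,\dots,i_m\in I$, $\epsilon_1,\dots,\epsilon_m\in\{1,*\}$.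 A family in $D(\omega)$ is trace class with respect to $\omega$ if it has the same distribution as a family of trace class operators on some separable complex Hilbert space $H$ with respect to the trace $\operatorname{Tr}_H$. If a single element $a$ is trace class, $\operatorname{EV}(a)$ is the multiset of nonzero eigenvalues, counted with algebraic multiplicity, of a trace class operator on a separable Hilbert space with the same distribution as $a$; it is called well defined if all such operators give the same multiset. *Cyclic monotonicity.* Let $\mathfrak A,\mathfrak B\subseteq\mathcal A$ be $*$-subalgebras with $1\in\mathfrak B$, and let $I_{\mathfrak B}(\mathfrak A)$ be the span of all products $b_0a_1b_1\cdots a_mb_m$ with $m\ge1$, $a_i\in\mathfrak A$, $b_i\in\mathfrak B$. The pair $(\mathfrak A,\mathfrak B)$ is cyclically monotone with respect to $(\omega,\tau)$ if $I_{\mathfrak B}(\mathfrak A)\subseteq D(\omega)$ and $\omega(a_1b_1\cdots a_mb_m)=\omega(a_1\cdots a_m)\,\tau(b_1)\cdots\tau(b_m)$ for all $m\ge1$, $a_i\in\mathfrak A$, $b_i\in\mathfrak B$. **Theorem.** Let $k\ge1$, let $A_p=(a^{(p)}_{ij})\in M_n(D(\omega))$ for $p=1,\dots,k$ and $B_q=(b^{(q)}_{ij})\in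 M_n(\mathcal A)$ for $q=0,\dots,k$. Assume that the family $(a^{(p)}_{ij})_{p,i,j}$ is trace class with respect to $\omega$ and that $(\mathfrak A,\mathfrak B)$ is cyclically monotone with respect to $(\omega,\tau)$, where $\mathfrak A$ is the (non-unital) $*$-algebra generated by all $a^{(p)}_{ij}$ and $\mathfrak B$ is the unital $*$-algebra generated by all $b^{(q)}_{ij}$. For $B\in M_n(\mathcal A)$ let $B'=(\mathrm{id}\otimes\tau)(B)=(\tau(b_{ij}))_{i,j}\in M_n(\mathbb C)$, and put $$Y=B_0A_1B_1A_2B_2\cdots A_kB_k,\qquad Z=A_1B_1'A_2B_2'\cdots A_{k-1}B_{k-1}'A_k(B_kB_0)'.$$ Then, with respect to $\operatorname{Tr}_n\otimes\,\omega$: 1. $Z$ is trace class and $\operatorname{EV}(Z)$ is well defined; and if $Y$ is trace class, then $\operatorname{EV}(Y)$ is well defined and $$\operatorname{EV}(B_0A_1B_1\cdots A_kB_k)=\operatorname{EV}(A_1B_1'\cdots A_k(B_kB_0)').$$ 2. $Y$ is indeed trace class if $k\ge2$, and also for $k=1$ provided that $\omega(bx)=\omega(xb)$ for all $b\in\mathfrak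 B$ and $x\in I_{\mathfrak B}(\mathfrak A)$. -/

import Mathlib

section

open scoped ComplexOrder InnerProductSpace

universe u

/-! ### Tracial weights -/

/-- A tracial weight on a `*`-algebra `A` over `ℂ`: a linear functional `ω`, defined on a
(not necessarily unital) `*`-subalgebra `D(ω) ⊆ A`, which is tracial, selfadjoint and positive. -/
structure TracialWeight (A : Type*) [Ring A] [StarRing A] [Algebra ℂ A] where
  /-- The domain `D(ω)`. -/
  domain : NonUnitalStarSubalgebra ℂ A
  /-- The functional `ω : D(ω) → ℂ`. -/
  toFun : domain →ₗ[ℂ] ℂ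
  tracial : ∀ a b : domain, toFun (a * b) = toFun (b * a)
  selfadjoint : ∀ a : domain, toFun (star a) = star (toFun a)
  positive : ∀ a : domain, 0 ≤ toFun (star a * a)

/-- The weight `Tr_n ⊗ ω` on `M_n(A)`: its domain is `M_n(D(ω))`, and it sends a matrix to the sum
of the values of `ω` on its diagonal entries. -/
def TracialWeight.matrix {A : Type*} [Ring A] [StarRing A] [Algebra ℂ A] (ω : TracialWeight A)
    (n : Type*) [Fintype n] [DecidableEq n] : TracialWeight (Matrix n n A) where
  domain :=
    { carrier := {M | ∀ i j, M i j ∈ ω.domain}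
      zero_mem' := fun _ _ => zero_mem ω.domain
      add_mem' := fun hM hN i j => add_mem (hM i j) (hN i j)
      smul_mem' := fun c _ hM i j => SMulMemClass.smul_mem c (hM i j)
      mul_mem' := fun {M N} hM hN i j => by
        rw [Matrix.mul_apply]
        exact sum_mem fun l _ => mul_mem (hM i l) (hN l j)
      star_mem' := fun {M} hM i j => by
        rw [Matrix.star_apply]
        exact star_mem (hM j i) }
  toFun :=
    { toFun := fun M => ∑ i, ω.toFun ⟨M.1 i i, M.2 i i⟩
      map_add' := fun M N => by
        rw [← Finset.sum_add_distrib]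
        exact Finset.sum_congr rfl fun i _ => by rw [← map_add]; rfl
      map_smul' := fun c M => by
        rw [RingHom.id_apply, Finset.smul_sum]
        exact Finset.sum_congr rfl fun i _ => by rw [← map_smul]; rfl }
  tracial := fun M N => by
    have key : ∀ P Q : {M : Matrix n n A // ∀ i j, M i j ∈ ω.domain}, ∀ h : ∀ i,
        (P.1 * Q.1) i i ∈ ω.domain, ∑ i, ω.toFun ⟨(P.1 * Q.1) i i, h i⟩ =
        ∑ i, ∑ j, ω.toFun (⟨P.1 i j, P.2 i j⟩ * ⟨Q.1 j i, Q.2 j i⟩) := by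
      intro P Q h
      refine Finset.sum_congr rfl fun i _ => ?_
      rw [← map_sum]
      congr 1
      apply Subtype.ext
      simp [Matrix.mul_apply]
    refine (key ⟨M.1, M.2⟩ ⟨N.1, N.2⟩ fun i => (M * N).2 i i).trans
      (Eq.trans ?_ (key ⟨N.1, N.2⟩ ⟨M.1, M.2⟩ fun i => (N * M).2 i i).symm)
    rw [Finset.sum_comm]
    exact Finset.sum_congr rfl fun i _ => Finset.sum_congr rfl fun j _ => ω.tracial _ _
  selfadjoint := fun M => by
    refine Eq.trans ?_ (star_sum _ _).symm
    refine Finset.sum_congr rfl fun i _ => ?_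
    rw [← ω.selfadjoint]
    rfl
  positive := fun M => by
    refine Finset.sum_nonneg fun i _ => ?_
    have h : (⟨(star M * M).1 i i, (star M * M).2 i i⟩ : ω.domain) =
        ∑ j, star ⟨M.1 j i, M.2 j i⟩ * ⟨M.1 j i, M.2 j i⟩ := by
      apply Subtype.ext
      simp [Matrix.mul_apply]
    rw [h, map_sum]
    exact Finset.sum_nonneg fun j _ => ω.positive _

/-! ### Trace class operators and the trace on a Hilbert space -/

/-- A bounded operator `T` on a Hilbert space is trace class (nuclear) if it is the sum of a series
`∑ ⟪u n, ·⟫ v n` of operators of rank at most one whose norms `‖u n‖ ‖v n‖` are summable. For a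
selfadjoint compact operator this says that its eigenvalues, listed with multiplicity, are
absolutely summable. -/
def IsTraceClassOperator {H : Type*} [NormedAddCommGroup H] [InnerProductSpace ℂ H]
    (T : H →L[ℂ] H) : Prop :=
  ∃ u v : ℕ → H, Summable (fun n => ‖u n‖ * ‖v n‖) ∧
    ∀ h : H, HasSum (fun n => ⟪u n, h⟫_ℂ • v n) (T h)

/-- The trace `∑ ⟪e i, T (e i)⟫` of an operator, in some Hilbert basis `e` of the space. On trace
class operators the series converges and does not depend on the basis
(`hasSum_operatorTrace`). -/
noncomputable def operatorTrace {H : Type*} [NormedAddCommGroup H] [InnerProductSpace ℂ H]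
    [CompleteSpace H] (T : H →L[ℂ] H) : ℂ :=
  ∑' i, ⟪(exists_hilbertBasis ℂ H).choose_spec.choose i,
    T ((exists_hilbertBasis ℂ H).choose_spec.choose i)⟫_ℂ

section HilbertSpace

variable {H : Type u} [NormedAddCommGroup H] [InnerProductSpace ℂ H]

theorem sum_norm_inner_mul_inner_le {ι : Type*} {e : ι → H} (he : Orthonormal ℂ e) (x y : H)
    (s : Finset ι) : ∑ i ∈ s, ‖⟪x, e i⟫_ℂ * ⟪e i, y⟫_ℂ‖ ≤ ‖x‖ * ‖y‖ := by
  have h := Real.sum_mul_le_sqrt_mul_sqrt s (fun i => ‖⟪x, e i⟫_ℂ‖) (fun i => ‖⟪e i, y⟫_ℂ‖)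
  simp only [norm_mul]
  refine h.trans (mul_le_mul ?_ ?_ (Real.sqrt_nonneg _) (norm_nonneg _))
  · rw [Real.sqrt_le_left (norm_nonneg _)]
    simp only [norm_inner_symm x]
    exact he.sum_inner_products_le x
  · rw [Real.sqrt_le_left (norm_nonneg _)]
    exact he.sum_inner_products_le y

theorem hasSum_trace_of_nuclear {ι : Type*} (e : HilbertBasis ι ℂ H) {T : H →L[ℂ] H}
    {u v : ℕ → H} (hs : Summable fun n => ‖u n‖ * ‖v n‖)
    (hT : ∀ h : H, HasSum (fun n => ⟪u n, h⟫_ℂ • v n) (T h)) :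
    HasSum (fun i => ⟪e i, T (e i)⟫_ℂ) (∑' n, ⟪u n, v n⟫_ℂ) := by
  have hsum : Summable fun p : ℕ × ι => ⟪u p.1, e p.2⟫_ℂ * ⟪e p.2, v p.1⟫_ℂ := by
    apply Summable.of_norm
    rw [summable_prod_of_nonneg fun _ => norm_nonneg _]
    have h1 : ∀ n, Summable fun i => ‖⟪u n, e i⟫_ℂ * ⟪e i, v n⟫_ℂ‖ := fun n =>
      summable_of_sum_le (fun _ => norm_nonneg _)
        (sum_norm_inner_mul_inner_le e.orthonormal (u n) (v n))
    refine ⟨h1, Summable.of_nonneg_of_le (fun n => tsum_nonneg fun _ => norm_nonneg _)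
      (fun n => ?_) hs⟩
    exact Real.tsum_le_of_sum_le (fun _ => norm_nonneg _)
      (sum_norm_inner_mul_inner_le e.orthonormal (u n) (v n))
  have h2 : HasSum (fun p : ℕ × ι => ⟪u p.1, e p.2⟫_ℂ * ⟪e p.2, v p.1⟫_ℂ)
      (∑' n, ⟪u n, v n⟫_ℂ) := by
    convert! hsum.hasSum using 1
    rw [hsum.tsum_prod]
    exact tsum_congr fun n => (e.tsum_inner_mul_inner (u n) (v n)).symm
  have h3 := (Equiv.prodComm ι ℕ).hasSum_iff.2 h2
  refine h3.prod_fiberwise fun i => ?_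
  have h4 := (hT (e i)).mapL (innerSL ℂ (e i))
  simpa [inner_smul_right] using h4

variable [CompleteSpace H]

theorem operatorTrace_eq_of_nuclear {T : H →L[ℂ] H} {u v : ℕ → H}
    (hs : Summable fun n => ‖u n‖ * ‖v n‖)
    (hT : ∀ h : H, HasSum (fun n => ⟪u n, h⟫_ℂ • v n) (T h)) :
    operatorTrace T = ∑' n, ⟪u n, v n⟫_ℂ :=
  (hasSum_trace_of_nuclear (exists_hilbertBasis ℂ H).choose_spec.choose hs hT).tsum_eq

theorem hasSum_operatorTrace {ι : Type*} (e : HilbertBasis ι ℂ H) {T : H →L[ℂ] H}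
    (hT : IsTraceClassOperator T) :
    HasSum (fun i => ⟪e i, T (e i)⟫_ℂ) (operatorTrace T) := by
  obtain ⟨u, v, hs, h⟩ := hT
  rw [operatorTrace_eq_of_nuclear hs h]
  exact hasSum_trace_of_nuclear e hs h

theorem summable_smul_of_nuclear {u v : ℕ → H} (hs : Summable fun n => ‖u n‖ * ‖v n‖) (h : H) :
    Summable fun n => ⟪u n, h⟫_ℂ • v n := by
  refine Summable.of_norm_bounded (hs.mul_right ‖h‖) fun n => ?_
  rw [norm_smul]
  calc ‖⟪u n, h⟫_ℂ‖ * ‖v n‖ ≤ (‖u n‖ * ‖h‖) * ‖v n‖ :=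
        mul_le_mul_of_nonneg_right (norm_inner_le_norm _ _) (norm_nonneg _)
    _ = ‖u n‖ * ‖v n‖ * ‖h‖ := by ring

theorem nuclear_comp_left (S : H →L[ℂ] H) {T : H →L[ℂ] H} {u v : ℕ → H}
    (hs : Summable fun n => ‖u n‖ * ‖v n‖)
    (hT : ∀ h : H, HasSum (fun n => ⟪u n, h⟫_ℂ • v n) (T h)) :
    (Summable fun n => ‖u n‖ * ‖S (v n)‖) ∧
      ∀ h : H, HasSum (fun n => ⟪u n, h⟫_ℂ • S (v n)) ((S * T) h) := by
  refine ⟨Summable.of_nonneg_of_le (fun n => by positivity) (fun n => ?_) (hs.mul_right ‖S‖),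
    fun h => ?_⟩
  · calc ‖u n‖ * ‖S (v n)‖ ≤ ‖u n‖ * (‖S‖ * ‖v n‖) :=
          mul_le_mul_of_nonneg_left (S.le_opNorm _) (norm_nonneg _)
      _ = ‖u n‖ * ‖v n‖ * ‖S‖ := by ring
  · simpa using (hT h).mapL S

theorem nuclear_comp_right (S : H →L[ℂ] H) {T : H →L[ℂ] H} {u v : ℕ → H}
    (hs : Summable fun n => ‖u n‖ * ‖v n‖)
    (hT : ∀ h : H, HasSum (fun n => ⟪u n, h⟫_ℂ • v n) (T h)) :
    (Summable fun n => ‖S.adjoint (u n)‖ * ‖v n‖) ∧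
      ∀ h : H, HasSum (fun n => ⟪S.adjoint (u n), h⟫_ℂ • v n) ((T * S) h) := by
  refine ⟨Summable.of_nonneg_of_le (fun n => by positivity) (fun n => ?_)
    (hs.mul_right ‖S.adjoint‖), fun h => ?_⟩
  · calc ‖S.adjoint (u n)‖ * ‖v n‖ ≤ (‖S.adjoint‖ * ‖u n‖) * ‖v n‖ :=
          mul_le_mul_of_nonneg_right (S.adjoint.le_opNorm _) (norm_nonneg _)
      _ = ‖u n‖ * ‖v n‖ * ‖S.adjoint‖ := by ring
  · simpa [ContinuousLinearMap.adjoint_inner_left] using hT (S h)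

theorem nuclear_star {T : H →L[ℂ] H} {u v : ℕ → H}
    (hs : Summable fun n => ‖u n‖ * ‖v n‖)
    (hT : ∀ h : H, HasSum (fun n => ⟪u n, h⟫_ℂ • v n) (T h)) :
    (Summable fun n => ‖v n‖ * ‖u n‖) ∧
      ∀ h : H, HasSum (fun n => ⟪v n, h⟫_ℂ • u n) ((star T) h) := by
  have hs' : Summable fun n => ‖v n‖ * ‖u n‖ := by simpa only [mul_comm] using hs
  refine ⟨hs', fun h => ?_⟩
  have h1 := (summable_smul_of_nuclear hs' h).hasSum
  convert! h1 using 1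
  refine ext_inner_left ℂ fun w => ?_
  rw [ContinuousLinearMap.star_eq_adjoint, ContinuousLinearMap.adjoint_inner_right]
  have h2 := h1.mapL (innerSL ℂ w)
  have h3 := (hT w).mapL (innerSL ℂ h)
  have h4 := h3.star
  have h5 : HasSum (fun n => innerSL ℂ w (⟪v n, h⟫_ℂ • u n)) ⟪T w, h⟫_ℂ := by
    convert! h4 using 1
    · ext n
      simp [mul_comm]
    · simp
  exact h5.unique h2

theorem nuclear_add {S T : H →L[ℂ] H} (hS : IsTraceClassOperator S)
    (hT : IsTraceClassOperator T) : IsTraceClassOperator (S + T) := by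
  obtain ⟨u, v, hs, h⟩ := hS
  obtain ⟨u', v', hs', h'⟩ := hT
  refine ⟨fun n => Sum.elim u u' (Equiv.natSumNatEquivNat.symm n),
    fun n => Sum.elim v v' (Equiv.natSumNatEquivNat.symm n), ?_, fun w => ?_⟩
  · refine (Equiv.summable_iff Equiv.natSumNatEquivNat).1 ?_
    refine Summable.sum _ ?_ ?_
    · simpa [Function.comp_def] using hs
    · simpa [Function.comp_def] using hs'
  · refine (Equiv.hasSum_iff Equiv.natSumNatEquivNat).1 ?_
    refine HasSum.sum ?_ ?_
    · simpa [Function.comp_def] using h w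
    · simpa [Function.comp_def] using h' w

theorem operatorTrace_add {S T : H →L[ℂ] H} (hS : IsTraceClassOperator S)
    (hT : IsTraceClassOperator T) :
    operatorTrace (S + T) = operatorTrace S + operatorTrace T := by
  have e := (exists_hilbertBasis ℂ H).choose_spec.choose
  have h1 := (hasSum_operatorTrace e hS).add (hasSum_operatorTrace e hT)
  refine (hasSum_operatorTrace e (nuclear_add hS hT)).unique ?_
  convert! h1 using 2
  simp

theorem nuclear_smul (c : ℂ) {T : H →L[ℂ] H} (hT : IsTraceClassOperator T) :
    IsTraceClassOperator (c • T) := by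
  obtain ⟨u, v, hs, h⟩ := hT
  obtain ⟨h1, h2⟩ := nuclear_comp_left (c • (1 : H →L[ℂ] H)) hs h
  exact ⟨u, _, h1, fun w => by simpa using h2 w⟩

theorem operatorTrace_smul (c : ℂ) {T : H →L[ℂ] H} (hT : IsTraceClassOperator T) :
    operatorTrace (c • T) = c * operatorTrace T := by
  have e := (exists_hilbertBasis ℂ H).choose_spec.choose
  have h1 := (hasSum_operatorTrace e hT).mul_left c
  refine (hasSum_operatorTrace e (nuclear_smul c hT)).unique ?_
  convert! h1 using 2
  simp

theorem isTraceClassOperator_mul (S : H →L[ℂ] H) {T : H →L[ℂ] H}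
    (hT : IsTraceClassOperator T) : IsTraceClassOperator (S * T) := by
  obtain ⟨u, v, hs, h⟩ := hT
  obtain ⟨h1, h2⟩ := nuclear_comp_left S hs h
  exact ⟨u, _, h1, h2⟩

theorem operatorTrace_mul_comm (S : H →L[ℂ] H) {T : H →L[ℂ] H}
    (hT : IsTraceClassOperator T) : operatorTrace (S * T) = operatorTrace (T * S) := by
  obtain ⟨u, v, hs, h⟩ := hT
  obtain ⟨h1, h2⟩ := nuclear_comp_left S hs h
  obtain ⟨h3, h4⟩ := nuclear_comp_right S hs h
  rw [operatorTrace_eq_of_nuclear h1 h2, operatorTrace_eq_of_nuclear h3 h4]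
  exact tsum_congr fun n => (ContinuousLinearMap.adjoint_inner_left _ _ _).symm

theorem isTraceClassOperator_star {T : H →L[ℂ] H} (hT : IsTraceClassOperator T) :
    IsTraceClassOperator (star T) := by
  obtain ⟨u, v, hs, h⟩ := hT
  obtain ⟨h1, h2⟩ := nuclear_star hs h
  exact ⟨v, u, h1, h2⟩

theorem operatorTrace_star {T : H →L[ℂ] H} (hT : IsTraceClassOperator T) :
    operatorTrace (star T) = star (operatorTrace T) := by
  have e := (exists_hilbertBasis ℂ H).choose_spec.choose
  have h1 := (hasSum_operatorTrace e hT).star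
  refine (hasSum_operatorTrace e (isTraceClassOperator_star hT)).unique ?_
  convert! h1 using 2
  simp [ContinuousLinearMap.star_eq_adjoint, ContinuousLinearMap.adjoint_inner_right]

theorem operatorTrace_star_mul_self_nonneg {T : H →L[ℂ] H} (hT : IsTraceClassOperator T) :
    0 ≤ operatorTrace (star T * T) := by
  have e := (exists_hilbertBasis ℂ H).choose_spec.choose
  refine (hasSum_operatorTrace e (isTraceClassOperator_mul _ hT)).nonneg fun i => ?_
  have : ⟪e i, (star T * T) (e i)⟫_ℂ = ⟪T (e i), T (e i)⟫_ℂ := by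
    rw [ContinuousLinearMap.star_eq_adjoint]
    exact ContinuousLinearMap.adjoint_inner_right T _ _
  rw [this, inner_self_eq_norm_sq_to_K, ← RCLike.ofReal_pow]
  exact Complex.zero_le_real.2 (sq_nonneg ‖T (e i)‖)

end HilbertSpace

/-- The `*`-algebra of trace class operators on a Hilbert space. -/
def traceClassOperators (H : Type*) [NormedAddCommGroup H] [InnerProductSpace ℂ H]
    [CompleteSpace H] : NonUnitalStarSubalgebra ℂ (H →L[ℂ] H) where
  carrier := {T | IsTraceClassOperator T}
  zero_mem' := ⟨0, 0, by simp [summable_zero], fun h => by simp [hasSum_zero]⟩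
  add_mem' := nuclear_add
  smul_mem' := fun c _ hT => nuclear_smul c hT
  mul_mem' := fun {S _} _ hT => isTraceClassOperator_mul S hT
  star_mem' := isTraceClassOperator_star

/-- The trace `Tr_H` of a Hilbert space `H`, as a tracial weight on the `*`-algebra of bounded
operators on `H`. Its domain is the set of trace class operators. -/
noncomputable def hilbertTrace (H : Type*) [NormedAddCommGroup H] [InnerProductSpace ℂ H]
    [CompleteSpace H] : TracialWeight (H →L[ℂ] H) where
  domain := traceClassOperators H
  toFun :=
    { toFun := fun T => operatorTrace (T : H →L[ℂ] H)
      map_add' := fun S T => operatorTrace_add S.2 T.2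
      map_smul' := fun c T => operatorTrace_smul c T.2 }
  tracial := fun S T => operatorTrace_mul_comm (S : H →L[ℂ] H) T.2
  selfadjoint := fun T => operatorTrace_star T.2
  positive := fun T => operatorTrace_star_mul_self_nonneg T.2

/-! ### Distributions, trace class families and eigenvalues -/

section Distribution

variable {A : Type*} [Ring A] [StarRing A] [Algebra ℂ A] {ι : Type*}

/-- The letter `a_i` (for `(i, false)`) or `a_i^*` (for `(i, true)`). -/
def starLetter {D : Type*} [Star D] (a : ι → D) (p : ι × Bool) : D :=
  if p.2 then star (a p.1) else a p.1

/-- The moment `ω(a_{i_1}^{ε_1} ⋯ a_{i_m}^{ε_m})`, `m ≥ 1`, where `p = (i_1, ε_1)` is the first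
letter and `w` lists the remaining `m - 1` letters. -/
def TracialWeight.moment (ω : TracialWeight A) (a : ι → ω.domain) (p : ι × Bool)
    (w : List (ι × Bool)) : ℂ :=
  ω.toFun (w.foldl (fun x q => x * starLetter a q) (starLetter a p))

/-- The families `a` and `b` have the same distribution with respect to `ω` and `ψ`. -/
def SameDistribution {B : Type*} [Ring B] [StarRing B] [Algebra ℂ B]
    (ω : TracialWeight A) (a : ι → ω.domain) (ψ : TracialWeight B) (b : ι → ψ.domain) : Prop :=
  ∀ (p : ι × Bool) (w : List (ι × Bool)), ω.moment a p w = ψ.moment b p w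

/-- The family `a` of elements of `A` is trace class with respect to `ω`: its members lie in
`D(ω)`, and it has the same distribution as some family of trace class operators on a separable
Hilbert space. (Every separable Hilbert space is isomorphic to one in `Type`.) -/
def IsTraceClass (ω : TracialWeight A) (a : ι → A) : Prop :=
  ∃ ha : ∀ i, a i ∈ ω.domain,
    ∃ (H : Type) (_ : NormedAddCommGroup H) (_ : InnerProductSpace ℂ H) (_ : CompleteSpace H)
      (_ : TopologicalSpace.SeparableSpace H) (x : ι → (hilbertTrace H).domain),
      SameDistribution ω (fun i => ⟨a i, ha i⟩) (hilbertTrace H) x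

/-- The multiset of nonzero eigenvalues of an operator `x`, given by its multiplicity function:
each `z ≠ 0` is counted with its algebraic multiplicity, the dimension of `⋃ r, ker (x - z) ^ r`
(this is `0` if `z` is not an eigenvalue, and it is finite if `x` is compact). -/
noncomputable def eigenvalueMultiplicity {H : Type*} [NormedAddCommGroup H]
    [InnerProductSpace ℂ H] (x : H →L[ℂ] H) (z : {z : ℂ // z ≠ 0}) : ℕ :=
  Module.finrank ℂ (Module.End.maxGenEigenspace (x : H →ₗ[ℂ] H) (z : ℂ))

/-- `HasEV ω a μ`: the multiset `EV(a)` of eigenvalues of `a` with respect to `ω` is well defined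
and is the one with multiplicity function `μ`. That is, the single element `a` is trace class with
respect to `ω`, and *every* trace class operator `x` on a separable Hilbert space with the same
distribution as `a` has exactly the eigenvalues `μ`. -/
def HasEV (ω : TracialWeight A) (a : A) (μ : {z : ℂ // z ≠ 0} → ℕ) : Prop :=
  IsTraceClass ω (fun _ : Unit => a) ∧
    ∀ ha : a ∈ ω.domain,
    ∀ (H : Type) (_ : NormedAddCommGroup H) (_ : InnerProductSpace ℂ H) (_ : CompleteSpace H)
      (_ : TopologicalSpace.SeparableSpace H) (x : (hilbertTrace H).domain),
      SameDistribution ω (fun _ : Unit => ⟨a, ha⟩) (hilbertTrace H) (fun _ : Unit => x) →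
        eigenvalueMultiplicity (x : H →L[ℂ] H) = μ

end Distribution

/-! ### Cyclic monotone independence -/

section CyclicMonotone

variable {C : Type*} [Ring C] [StarRing C] [Algebra ℂ C] [StarModule ℂ C]

/-- The ideal `I_B(A)`, the span of the products `b_0 a_1 b_1 ⋯ a_m b_m` with `m ≥ 1`, `a_i ∈ A`,
`b_i ∈ B`; the list `l` holds the pairs `(a_i, b_i)`. -/
def cyclicIdeal (A : NonUnitalStarSubalgebra ℂ C) (B : StarSubalgebra ℂ C) : Submodule ℂ C :=
  Submodule.span ℂ {x | ∃ b₀ ∈ B, ∃ l : List (A × B), l ≠ [] ∧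
    x = b₀ * (l.map fun p => (p.1 : C) * (p.2 : C)).prod}

/-- The pair `(A, B)` of `*`-subalgebras (`B` unital) is cyclically monotone with respect to
`(ω, τ)`: `I_B(A) ⊆ D(ω)`, and
`ω(a_1 b_1 ⋯ a_m b_m) = ω(a_1 ⋯ a_m) τ(b_1) ⋯ τ(b_m)` for `m ≥ 1`. -/
def IsCyclicallyMonotone (ω : TracialWeight C) (τ : C →ₗ[ℂ] ℂ)
    (A : NonUnitalStarSubalgebra ℂ C) (B : StarSubalgebra ℂ C) : Prop :=
  (∀ x ∈ cyclicIdeal A B, x ∈ ω.domain) ∧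
    ∀ l : List (A × B), l ≠ [] →
      ∃ (h₁ : (l.map fun p => (p.1 : C) * (p.2 : C)).prod ∈ ω.domain)
        (h₂ : (l.map fun p => (p.1 : C)).prod ∈ ω.domain),
        ω.toFun ⟨_, h₁⟩ = ω.toFun ⟨_, h₂⟩ * (l.map fun p => τ (p.2 : C)).prod

/-- `B' = (id ⊗ τ)(B)`, the scalar matrix of the expectations of the entries, regarded as a matrix
over the algebra. -/
def expectationMatrix {n : Type*} (τ : C →ₗ[ℂ] ℂ) (M : Matrix n n C) : Matrix n n C :=
  (M.map τ).map (algebraMap ℂ C)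

end CyclicMonotone

end

/-! ### Riesz theory of compact operators on a Hilbert space -/

section SpectralTheory

open scoped InnerProductSpace
open Filter Topology

variable {H : Type*} [NormedAddCommGroup H] [InnerProductSpace ℂ H] [CompleteSpace H]

/-! Eigenvalues. The nonzero eigenvalues of a trace class operator `T`, with multiplicity, are
encoded in the function `Tr (T (1 - z T)⁻¹)`. Its Taylor coefficients at `0` are `Tr (T ^ (m + 1))`,
and at the reciprocal of a nonzero `l` it has at most a simple pole, with residue minus the
dimension of the generalized eigenspace of `l`. Two operators with equal traces of powers `m ≥ 2`
therefore have functions differing by a constant near `0`. The singularities are countable, so the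
common domain is connected, the difference is constant throughout, and the residues agree
(`eigenvalueMultiplicity_eq_of_operatorTrace_pow_eq`). Ignoring the first moment is essential: it is
not determined for `Y` when no commutation of `ω` with `𝔅` is available.

Moments. Write `Y = B₀ U` with `U = A₁ B₁ ⋯ A_k B_k`. Although `B₀` need not lie in the domain of
the weight, traciality gives the same value on `(B₀ U) ^ m` and `(U B₀) ^ m` for `m ≥ 2`, since
there are two factors in the ideal. Each `A_p` in `U B₀` is then followed by a matrix over `𝔅`, so
cyclic monotonicity replaces these matrices by their expectations and yields the moment of `Z ^ m`.
The bookkeeping uses algebras of pairs in `𝒜 × B(H)`, generated by `(a, x)` or by `(a b, τ(b) x)`,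
with `x` the operator model of `a`: on both, the weight of the first component is the trace of the
second (`extend_eq_of_mem_pairAlgebra`, `extend_eq_of_mem_cyclicPairAlgebra`). The pair `(Z, Zx)`
lies over the first algebra and `(U B₀, Zx)` over the second, with the same operator matrix `Zx`.

Trace class property of `Y`. All `*`-moments of `Y` must be realized, so the expectations of `B₀*
B₀`, `B₀* B_k*`, `B_k B₀`, `B_k B_k*` all occur. Unless `ω` vanishes on `𝔄`, positivity of `ω`
forces `τ` to be positive on `𝔅`; in the degenerate case `0` can take its place
(`IsCyclicallyMonotone.exists_positive`). Hence these four expectations form a Gram matrix of scalar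
matrices, which play the roles of `B₀` and `B_k*`; sandwiching the model of the middle part of `Y`
between them gives the required operator (`exists_matrix_moments_eq`). -/

theorem IsTraceClassOperator.isCompactOperator {T : H →L[ℂ] H} (hT : IsTraceClassOperator T) :
    IsCompactOperator T := by
  obtain ⟨u, v, hs, h⟩ := hT
  have hsum : Summable fun n => InnerProductSpace.rankOne ℂ (v n) (u n) :=
    Summable.of_norm (by simpa [mul_comm] using hs)
  have hT' : HasSum (fun n => InnerProductSpace.rankOne ℂ (v n) (u n)) T := by
    convert! hsum.hasSum using 1
    ext x
    have := hsum.hasSum.mapL (ContinuousLinearMap.apply ℂ H x)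
    exact (h x).unique (by simpa using this)
  refine isCompactOperator_of_tendsto hT' (Eventually.of_forall fun s => ?_)
  refine (compactOperator (RingHom.id ℂ) H H).sum_mem fun n _ => ?_
  have h1 : IsCompactOperator (innerSL ℂ (u n)) :=
    isCompactOperator_of_locallyCompactSpace_dom _
  exact h1.clm_comp (ContinuousLinearMap.toSpanSingleton ℂ (v n))

/-- The Fredholm alternative: a nonzero number that is not an eigenvalue of a compact operator lies
in its resolvent set. -/
theorem isUnit_smul_one_sub_of_isCompactOperator {K : H →L[ℂ] H} (hK : IsCompactOperator K)
    {c : ℂ} (hc : c ≠ 0) (hinj : ∀ x, K x = c • x → x = 0) : IsUnit (c • 1 - K) := by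
  rcases hK.hasEigenvalue_or_mem_resolventSet hc with h | h
  · obtain ⟨x, hx⟩ := h.exists_hasEigenvector
    exact absurd (hinj x (by simpa using hx.apply_eq_smul)) hx.2
  · rwa [spectrum.mem_resolventSet_iff, Algebra.algebraMap_eq_smul_one] at h

theorem isUnit_one_sub_of_isCompactOperator {K : H →L[ℂ] H} (hK : IsCompactOperator K)
    (hinj : ∀ x, K x = x → x = 0) : IsUnit (1 - K) := by
  simpa using isUnit_smul_one_sub_of_isCompactOperator hK one_ne_zero (by simpa using hinj)

theorem exists_isCompactOperator_sub_smul_one_pow {T : H →L[ℂ] H} (hT : IsCompactOperator T)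
    (l : ℂ) (r : ℕ) :
    ∃ K : H →L[ℂ] H, IsCompactOperator K ∧ (T - l • 1) ^ r = (-l) ^ r • 1 + K := by
  induction r with
  | zero => exact ⟨0, isCompactOperator_zero, by simp⟩
  | succ r ih =>
    obtain ⟨K, hK, h⟩ := ih
    refine ⟨(-l) ^ r • T + (T - l • 1) * K, 
      IsCompactOperator.add (f := ⇑((-l) ^ r • T)) (g := ⇑((T - l • 1) * K))
        (hT.smul ((-l) ^ r)) (by convert! hK.clm_comp (T - l • 1)), ?_⟩
    rw [pow_succ', h, mul_add, mul_smul_comm, mul_one, smul_sub, smul_smul, pow_succ, ← add_assoc,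
      mul_neg, neg_smul]
    abel

/-- Since `(T - l) ^ r` is a nonzero scalar plus a compact operator `K`, on its kernel `K` acts as a
nonzero scalar. So the identity of the kernel is compact. -/
theorem finiteDimensional_ker_sub_smul_one_pow {T : H →L[ℂ] H} (hT : IsCompactOperator T)
    {l : ℂ} (hl : l ≠ 0) (r : ℕ) : FiniteDimensional ℂ ((T - l • 1) ^ r).ker := by
  obtain ⟨K, hK, h⟩ := exists_isCompactOperator_sub_smul_one_pow hT l r
  have hc : (-l) ^ r ≠ 0 := pow_ne_zero _ (neg_ne_zero.2 hl)
  have hV : ∀ x ∈ ((T - l • 1) ^ r).ker, K x = -(-l) ^ r • x := fun x hx => by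
    have : ((T - l • 1) ^ r) x = 0 := hx
    rw [h] at this
    simpa [neg_smul] using eq_neg_of_add_eq_zero_right this
  have hmap : ∀ x ∈ ((T - l • 1) ^ r).ker, (K : H →ₗ[ℂ] H) x ∈ ((T - l • 1) ^ r).ker :=
    fun x hx => by
      have := hV x hx
      rw [ContinuousLinearMap.coe_coe, this]
      exact Submodule.smul_mem _ _ hx
  have h1 := IsCompactOperator.restrict' (f := (K : H →ₗ[ℂ] H)) hK hmap
  refine FiniteDimensional.of_isCompactOperator_id (𝕜 := ℂ) ?_
  have h2 := h1.smul (-(-l) ^ r)⁻¹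
  convert! h2 using 1
  ext x
  simp [LinearMap.restrict_apply, hV x.1 x.2, hc]

/-- If the kernels grew forever, there would be unit vectors `x r` in the kernel of the power `r +
1`, orthogonal to that of the power `r`. Their images under `T` stay at mutual distance at least
`‖l‖`, against compactness. -/
theorem exists_ker_sub_smul_one_pow_stable {T : H →L[ℂ] H} (hT : IsCompactOperator T)
    {l : ℂ} (hl : l ≠ 0) :
    ∃ r : ℕ, ∀ x, ((T - l • 1) ^ (r + 1)) x = 0 → ((T - l • 1) ^ r) x = 0 := by
  set S := T - l • 1 with hS
  by_contra! hcon
  have hseq : ∀ r : ℕ, ∃ x : H, ‖x‖ = 1 ∧ (S ^ (r + 1)) x = 0 ∧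
      ∀ w, (S ^ r) w = 0 → ⟪w, x⟫_ℂ = 0 := by
    intro r
    obtain ⟨x, hx1, hx2⟩ := hcon r
    set V := (S ^ r).ker
    set y := x - V.starProjection x with hy
    have hP : (S ^ r) (V.starProjection x) = 0 := V.starProjection_apply_mem x
    have hy0 : (S ^ r) y = (S ^ r) x := by rw [hy, map_sub, hP, sub_zero]
    have hyne : y ≠ 0 := fun h => hx2 (by rw [← hy0, h, map_zero])
    refine ⟨(‖y‖⁻¹ : ℂ) • y, ?_, ?_, fun w hw => ?_⟩
    · simp [norm_smul, hyne]
    · rw [map_smul, pow_succ', mul_apply_eq_comp, hy0,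
        ← mul_apply_eq_comp, ← pow_succ', hx1, smul_zero]
    · rw [inner_smul_right, V.sub_starProjection_mem_orthogonal x w hw, mul_zero]
  choose x hx1 hx2 hx3 using hseq
  have hmono : ∀ {m n : ℕ} (w : H), m ≤ n → (S ^ m) w = 0 → (S ^ n) w = 0 := by
    intro m n w hmn hw
    obtain ⟨j, rfl⟩ := Nat.exists_eq_add_of_le' hmn
    rw [pow_add, mul_apply_eq_comp, hw, map_zero]
  have hTS : ∀ w, T w = S w + l • w := fun w => by simp [hS]
  have hdist : ∀ m n, m < n → ‖l‖ ≤ ‖T (x n) - T (x m)‖ := by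
    intro m n hmn
    -- `T (x n) - T (x m)` is `l • x n` plus a vector of the kernel of `S ^ n`, to which `x n` is
    -- orthogonal.
    have hw : (S ^ n) (S (x n) - T (x m)) = 0 := by
      rw [map_sub, ← mul_apply_eq_comp, ← pow_succ, hx2, hTS, map_add, map_smul,
        ← mul_apply_eq_comp, ← pow_succ, hmono _ (by omega) (hx2 m),
        hmono _ (by omega : m + 1 ≤ n) (hx2 m)]
      simp
    have hin := hx3 n _ hw
    have heq : ⟪x n, T (x n) - T (x m)⟫_ℂ = l := by
      have : T (x n) - T (x m) = (S (x n) - T (x m)) + l • x n := by rw [hTS (x n)]; abel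
      rw [this, inner_add_right, inner_smul_right, inner_self_eq_norm_sq_to_K, hx1,
        ← inner_conj_symm, hin]
      simp
    calc ‖l‖ = ‖⟪x n, T (x n) - T (x m)⟫_ℂ‖ := by rw [heq]
      _ ≤ ‖x n‖ * ‖T (x n) - T (x m)‖ := norm_inner_le_norm _ _
      _ = _ := by rw [hx1, one_mul]
  obtain ⟨C, hC, hC'⟩ := hT.image_closedBall_subset_compact (𝕜₁ := ℂ) 1
  obtain ⟨y, -, ψ, hψ, hψy⟩ := hC.tendsto_subseq (fun n => hC' ⟨x n, by simp [hx1], rfl⟩)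
  obtain ⟨N, hN⟩ := Metric.cauchySeq_iff'.1 hψy.cauchySeq ‖l‖ (norm_pos_iff.2 hl)
  have h1 := hN (N + 1) (by omega)
  rw [dist_eq_norm] at h1
  exact absurd (hdist _ _ (hψ (Nat.lt_succ_self N))) (not_le.2 h1)

/-- The Riesz projection of a compact operator onto the generalized eigenspace of a nonzero
number. -/
theorem exists_rieszProjection {T : H →L[ℂ] H} (hT : IsCompactOperator T) {l : ℂ} (hl : l ≠ 0) :
    ∃ P : H →L[ℂ] H, Commute P T ∧ P * P = P ∧ FiniteDimensional ℂ P.range ∧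
      P.range = Module.End.maxGenEigenspace (T : H →ₗ[ℂ] H) l ∧
      ∃ r : ℕ, (T - l • 1) ^ r * P = 0 := by
  obtain ⟨r, hr⟩ := exists_ker_sub_smul_one_pow_stable hT hl
  obtain ⟨K, hK, hpow⟩ := exists_isCompactOperator_sub_smul_one_pow hT l r
  have hfd := finiteDimensional_ker_sub_smul_one_pow hT hl r
  have hc : (-l) ^ r ≠ 0 := pow_ne_zero _ (neg_ne_zero.2 hl)
  set S := T - l • 1 with hS
  set V := (S ^ r).ker with hV
  have hmemV : ∀ x, x ∈ V ↔ (S ^ r) x = 0 := fun x => Iff.rfl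
  have hstab : ∀ (j : ℕ) (x : H), (S ^ (r + j)) x = 0 → (S ^ r) x = 0 := by
    intro j
    induction j with
    | zero => exact fun x hx => hx
    | succ j ih =>
      intro x hx
      refine ih x ?_
      rw [add_comm, pow_add, mul_apply_eq_comp] at hx ⊢
      have h1 : (S ^ (r + 1)) ((S ^ j) x) = 0 := by
        rw [← mul_apply_eq_comp, ← pow_add, ← hx, ← mul_apply_eq_comp,
          ← pow_add]
        congr 2
        omega
      have h2 := hr _ h1
      rw [← mul_apply_eq_comp, ← pow_add, add_comm, pow_add,
        mul_apply_eq_comp] at h2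
      exact h2
  have hST : Commute T S := by
    rw [hS]
    exact (Commute.refl T).sub_right ((Commute.one_right T).smul_right l)
  have hTSr : ∀ x, T ((S ^ r) x) = (S ^ r) (T x) := fun x =>
    DFunLike.congr_fun (hST.pow_right r).eq x
  have hTV : ∀ x ∈ V, T x ∈ V := fun x hx => by
    rw [hmemV, ← hTSr, (hmemV x).1 hx, map_zero]
  set PV : H →L[ℂ] H := V.starProjection with hPV
  have hPVmem : ∀ x, PV x ∈ V := fun x => V.starProjection_apply_mem x
  have hPVid : ∀ x ∈ V, PV x = x := fun x hx => Submodule.starProjection_eq_self_iff.2 hx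
  have hPVc : IsCompactOperator PV := by
    have h : IsCompactOperator (V.orthogonalProjectionOnto) :=
      isCompactOperator_of_locallyCompactSpace_dom _
    exact h.clm_comp V.subtypeL
  -- A compact perturbation of a nonzero scalar, so injectivity suffices. If `S ^ r x = -PV x`, then
  -- `S ^ (2 r) x = 0`, so `x ∈ V` by stability and `x = PV x = 0`.
  have hunit : IsUnit (S ^ r + PV) := by
    have h := isUnit_smul_one_sub_of_isCompactOperator (K := -(K + PV)) (hK.add hPVc).neg hc
      (fun x hx => ?_)
    · convert! h using 1
      rw [hpow]
      abel
    · have h1 : (S ^ r) x + PV x = 0 := by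
        rw [hpow]
        have : -(K x + PV x) = (-l) ^ r • x := by simpa using hx
        rw [add_apply, smul_apply,
          one_apply_eq_self, ← this]
        abel
      have h2 : (S ^ r) ((S ^ r) x) = 0 := by
        rw [eq_neg_of_add_eq_zero_left h1, map_neg, (hmemV _).1 (hPVmem x), neg_zero]
      have h3 : (S ^ r) x = 0 := hstab r x (by rw [pow_add]; exact h2)
      rw [h3, zero_add, hPVid x h3] at h1
      exact h1
  obtain ⟨G, hG⟩ := hunit
  have hinv1 : ∀ x, (S ^ r) ((↑G⁻¹ : H →L[ℂ] H) x) + PV ((↑G⁻¹ : H →L[ℂ] H) x) = x := fun x => by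
    have := G.mul_inv
    rw [hG] at this
    exact DFunLike.congr_fun this x
  have hinv2 : ∀ x, (↑G⁻¹ : H →L[ℂ] H) ((S ^ r) x + PV x) = x := fun x => by
    have := G.inv_mul
    rw [hG] at this
    exact DFunLike.congr_fun this x
  -- The projection onto `V = ker S ^ r` along the range of `S ^ r`. It commutes with `T`, unlike
  -- the orthogonal projection `PV` in general.
  set P : H →L[ℂ] H := PV * ↑G⁻¹ with hP
  have hPmem : ∀ x, P x ∈ V := fun x => hPVmem _
  have hPid : ∀ x ∈ V, P x = x := fun x hx => by
    have h1 : (↑G⁻¹ : H →L[ℂ] H) x = x := by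
      conv_lhs => rw [← hPVid x hx, ← zero_add (PV x), ← (hmemV x).1 hx]
      exact hinv2 x
    rw [hP, mul_apply_eq_comp, h1, hPVid x hx]
  have hPQ : ∀ y, P ((S ^ r) y) = 0 := fun y => by
    have h1 := hinv1 ((S ^ r) y)
    set z := (↑G⁻¹ : H →L[ℂ] H) ((S ^ r) y) with hz
    have h2 : (S ^ r) ((S ^ r) (y - z)) = 0 := by
      have : (S ^ r) (y - z) = PV z := by
        rw [map_sub, ← h1]
        abel
      rw [this]
      exact hPVmem z
    have h3 : (S ^ r) (y - z) = 0 := hstab r _ (by rw [pow_add]; exact h2)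
    rw [map_sub, sub_eq_zero] at h3
    rw [h3] at h1
    exact left_eq_add.1 h1.symm
  have hdec : ∀ x, (S ^ r) ((↑G⁻¹ : H →L[ℂ] H) x) + P x = x := hinv1
  have hrange : P.range = V := by
    refine le_antisymm ?_ fun x hx => ⟨x, hPid x hx⟩
    rintro _ ⟨x, rfl⟩
    exact hPmem x
  refine ⟨P, ?_, ?_, by rw [hrange]; exact hfd, ?_, r, ?_⟩
  · ext x
    rw [mul_apply_eq_comp, mul_apply_eq_comp]
    conv_lhs => rw [← hdec x]
    have h1 := map_add P ((S ^ r) (T ((↑G⁻¹ : H →L[ℂ] H) x))) (T (P x))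
    rwa [hPQ, zero_add, hPid _ (hTV _ (hPmem x)), ← hTSr, ← map_add] at h1
  · ext x
    exact hPid _ (hPmem x)
  · rw [hrange]
    ext x
    have hcoe : ∀ k : ℕ, (((T : H →ₗ[ℂ] H) - l • 1) ^ k) x = (S ^ k) x := fun k => by
      have : ((T : H →ₗ[ℂ] H) - l • 1) = (S : H →ₗ[ℂ] H) := by ext; simp [hS]
      rw [this, ← ContinuousLinearMap.toLinearMap_pow]
      rfl
    rw [Module.End.mem_maxGenEigenspace, hmemV]
    constructor
    · exact fun h => ⟨r, by rw [hcoe, h]⟩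
    · rintro ⟨k, hk⟩
      rw [hcoe] at hk
      exact hstab k x (by rw [pow_add, mul_apply_eq_comp, hk, map_zero])
  · ext x
    exact hPmem x

end SpectralTheory

/-! ### The trace of the resolvent determines the eigenvalue multiplicities -/

section TraceResolvent

open scoped InnerProductSpace
open Filter Topology

variable {H : Type*} [NormedAddCommGroup H] [InnerProductSpace ℂ H] [CompleteSpace H]

theorem isTraceClassOperator_mul_right (S : H →L[ℂ] H) {T : H →L[ℂ] H}
    (hT : IsTraceClassOperator T) : IsTraceClassOperator (T * S) := by
  obtain ⟨u, v, hs, h⟩ := hT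
  obtain ⟨h1, h2⟩ := nuclear_comp_right S hs h
  exact ⟨_, v, h1, h2⟩

theorem isTraceClassOperator_rankOne (x y : H) :
    IsTraceClassOperator (InnerProductSpace.rankOne ℂ x y) ∧
      operatorTrace (InnerProductSpace.rankOne ℂ x y) = ⟪y, x⟫_ℂ := by
  have h1 : Summable fun n : ℕ => ‖if n = 0 then y else 0‖ * ‖x‖ :=
    (hasSum_single 0 fun n hn => by simp [hn]).summable
  have h2 : ∀ h : H, HasSum (fun n : ℕ => ⟪if n = 0 then y else 0, h⟫_ℂ • x)
      (InnerProductSpace.rankOne ℂ x y h) := fun h => by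
    convert! hasSum_single (f := fun n : ℕ => ⟪if n = 0 then y else 0, h⟫_ℂ • x) 0
      (fun n hn => by simp [hn]) using 1
  refine ⟨⟨_, fun _ => x, h1, h2⟩, ?_⟩
  rw [operatorTrace_eq_of_nuclear (v := fun _ => x) h1 h2, tsum_eq_single 0 fun n hn => by simp [hn]]
  simp

theorem operatorTrace_zero : operatorTrace (0 : H →L[ℂ] H) = 0 := by
  simp [operatorTrace]

theorem isTraceClassOperator_sum {ι : Type*} (s : Finset ι) {F : ι → H →L[ℂ] H}
    (hF : ∀ i ∈ s, IsTraceClassOperator (F i)) :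
    IsTraceClassOperator (∑ i ∈ s, F i) ∧
      operatorTrace (∑ i ∈ s, F i) = ∑ i ∈ s, operatorTrace (F i) := by
  classical
  induction s using Finset.induction_on with
  | empty => exact ⟨zero_mem (traceClassOperators H), by simp [operatorTrace_zero]⟩
  | insert i s hi ih =>
    obtain ⟨h1, h2⟩ := ih fun j hj => hF j (Finset.mem_insert_of_mem hj)
    have h3 := hF i (Finset.mem_insert_self i s)
    rw [Finset.sum_insert hi, Finset.sum_insert hi, operatorTrace_add h3 h1, h2]
    exact ⟨nuclear_add h3 h1, rfl⟩

/-- For an orthonormal basis `b` of `V`, the operator `F` is the finite sum of the rank one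
operators `⟪F* b i, ·⟫ b i`, whose traces are the diagonal entries of the restriction. This brings
in finite-dimensional linear algebra. -/
theorem operatorTrace_eq_trace_restrict {F : H →L[ℂ] H} {V : Submodule ℂ H}
    [FiniteDimensional ℂ V] (hF : ∀ x, F x ∈ V) :
    IsTraceClassOperator F ∧ operatorTrace F =
      LinearMap.trace ℂ V ((F : H →ₗ[ℂ] H).restrict (q := V) fun x _ => hF x) := by
  have b := stdOrthonormalBasis ℂ V
  have hsum : F = ∑ i, InnerProductSpace.rankOne ℂ (b i : H) (F.adjoint (b i)) := by
    ext x
    have h := congrArg (Subtype.val) (b.sum_repr' ⟨F x, hF x⟩)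
    rw [sum_apply]
    simp only [InnerProductSpace.rankOne_apply, ContinuousLinearMap.adjoint_inner_left]
    simpa using h.symm
  obtain ⟨h1, h2⟩ := isTraceClassOperator_sum Finset.univ
    (fun i _ => (isTraceClassOperator_rankOne (b i : H) (F.adjoint (b i))).1)
  rw [← hsum] at h1 h2
  refine ⟨h1, h2.trans ?_⟩
  rw [LinearMap.trace_eq_sum_inner _ b]
  refine Finset.sum_congr rfl fun i _ => ?_
  rw [(isTraceClassOperator_rankOne _ _).2, ContinuousLinearMap.adjoint_inner_left]
  rfl

theorem operatorTrace_eq_zero_of_isNilpotent {F : H →L[ℂ] H} {V : Submodule ℂ H}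
    [FiniteDimensional ℂ V] (hF : ∀ x, F x ∈ V) (hnil : IsNilpotent F) : operatorTrace F = 0 := by
  rw [(operatorTrace_eq_trace_restrict hF).2]
  refine (LinearMap.isNilpotent_trace_of_isNilpotent ?_).eq_zero
  obtain ⟨m, hm⟩ := hnil
  refine ⟨m, ?_⟩
  rw [Module.End.pow_restrict]
  ext x
  have : ((F : H →ₗ[ℂ] H) ^ m) x = 0 := by
    rw [← ContinuousLinearMap.toLinearMap_pow, hm]
    rfl
  simpa [LinearMap.restrict_apply] using this

theorem operatorTrace_eq_finrank_of_isIdempotent {P : H →L[ℂ] H} (hP : P * P = P)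
    [FiniteDimensional ℂ P.range] :
    IsTraceClassOperator P ∧ operatorTrace P = Module.finrank ℂ P.range := by
  obtain ⟨h1, h2⟩ := operatorTrace_eq_trace_restrict (F := P) (V := P.range) fun x => ⟨x, rfl⟩
  refine ⟨h1, h2.trans ?_⟩
  rw [← LinearMap.trace_one]
  congr 1
  ext ⟨_, x, rfl⟩
  exact DFunLike.congr_fun hP x

/-- Composition with a trace class operator followed by the trace, as a continuous functional. -/
theorem exists_continuousLinearMap_operatorTrace_mul {T : H →L[ℂ] H}
    (hT : IsTraceClassOperator T) :
    ∃ φ : (H →L[ℂ] H) →L[ℂ] ℂ, ∀ R, φ R = operatorTrace (T * R) := by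
  refine ⟨LinearMap.mkContinuousOfExistsBound
    { toFun := fun R => operatorTrace (T * R)
      map_add' := fun R S => by
        rw [mul_add, operatorTrace_add (isTraceClassOperator_mul_right R hT)
          (isTraceClassOperator_mul_right S hT)]
      map_smul' := fun c R => by
        rw [mul_smul_comm, operatorTrace_smul c (isTraceClassOperator_mul_right R hT)]
        rfl } ?_, fun R => rfl⟩
  obtain ⟨u, v, hs, h⟩ := hT
  refine ⟨∑' n, ‖u n‖ * ‖v n‖, fun R => ?_⟩
  obtain ⟨h1, h2⟩ := nuclear_comp_right R hs h
  simp only [LinearMap.coe_mk, AddHom.coe_mk]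
  rw [operatorTrace_eq_of_nuclear h1 h2]
  refine tsum_of_norm_bounded (hs.hasSum.mul_right ‖R‖) fun n => ?_
  rw [ContinuousLinearMap.adjoint_inner_left]
  calc ‖⟪u n, R (v n)⟫_ℂ‖ ≤ ‖u n‖ * ‖R (v n)‖ := norm_inner_le_norm _ _
    _ ≤ ‖u n‖ * (‖R‖ * ‖v n‖) := mul_le_mul_of_nonneg_left (R.le_opNorm _) (norm_nonneg _)
    _ = ‖u n‖ * ‖v n‖ * ‖R‖ := by ring

/-- The inverse of `1 - z T` near the reciprocal `z₀` of a nonzero number: with the Riesz projection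
`P` of `T`, it is an operator depending continuously on `z`, plus the inverse on the generalized
eigenspace. -/
theorem exists_inverse_one_sub_smul_decomposition {T : H →L[ℂ] H} (hT : IsCompactOperator T)
    {z₀ : ℂ} (hz₀ : z₀ ≠ 0) :
    ∃ (P N : H →L[ℂ] H) (G W : ℂ → H →L[ℂ] H), P * P = P ∧ FiniteDimensional ℂ P.range ∧
      P.range = Module.End.maxGenEigenspace (T : H →ₗ[ℂ] H) z₀⁻¹ ∧
      ContinuousAt G z₀ ∧ ∀ᶠ z in 𝓝[≠] z₀, IsUnit (1 - z • T) ∧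
        Ring.inverse (1 - z • T) = G z * (1 - P) + W z * P ∧
        IsNilpotent (P * N * W z) ∧
        T * (W z * P) = (z₀ - z)⁻¹ • P + ((z₀ - z)⁻¹ * z + 1) • (P * N * W z) := by
  obtain ⟨P, hPT, hPP, hfd, hrange, r, hr⟩ := exists_rieszProjection hT (inv_ne_zero hz₀)
  set l := z₀⁻¹ with hl
  set N := (T - l • 1) * P with hN
  have hcT : Commute P (T - l • 1) := hPT.sub_right ((Commute.one_right P).smul_right l)
  have hPN : Commute P N := hcT.mul_right (Commute.refl P)
  have hTN : Commute T N :=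
    ((Commute.refl T).sub_right ((Commute.one_right T).smul_right l)).mul_right hPT.symm
  have hnil : IsNilpotent N := by
    refine ⟨r + 1, ?_⟩
    rw [hN, hcT.symm.mul_pow, (show IsIdempotentElem P from hPP).pow_succ_eq, pow_succ', mul_assoc,
      hr, mul_zero]
  have hNP : N * P = N := by rw [hN, mul_assoc, hPP]
  have hPN' : P * N = N := by rw [hPN.eq, hNP]
  set Aop : ℂ → H →L[ℂ] H := fun z => 1 - z • (T * (1 - P)) with hAop
  -- Removing the generalized eigenspace removes the singularity: a fixed vector of `z₀ T (1 - P)`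
  -- is killed by `P` and is fixed by `z₀ T`, so it lies in the range of `P` and vanishes.
  have hA0 : IsUnit (Aop z₀) := by
    refine isUnit_one_sub_of_isCompactOperator (K := z₀ • (T * (1 - P)))
      (IsCompactOperator.smul (f := ⇑(T * (1 - P))) (by convert! hT.comp_clm (1 - P)) z₀)
      fun x hx => ?_
    have h1 : P x = 0 := by
      rw [← hx]
      have : P * (z₀ • (T * (1 - P))) = 0 := by
        rw [mul_smul_comm, ← mul_assoc, hPT.eq, mul_assoc, mul_sub, mul_one, hPP, sub_self, mul_zero,
          smul_zero]
      exact DFunLike.congr_fun this x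
    have h2 : T x = l • x := by
      have h3 : z₀ • T x = x := by simpa [h1] using hx
      rw [eq_comm, hl, inv_smul_eq_iff₀ hz₀, h3]
    have h3 : x ∈ P.range := by
      rw [hrange]
      exact (Module.End.mem_maxGenEigenspace _ _ _).2 ⟨1, by simp [h2]⟩
    obtain ⟨y, rfl⟩ := h3
    have : P (P y) = P y := DFunLike.congr_fun hPP y
    exact this.symm.trans h1
  have hAc : Continuous Aop := by fun_prop
  -- On the range of `P`, where `T = l + N` with `N` nilpotent, `1 - z T` acts as `(1 - z l) - z N`.
  -- This is invertible for `z ≠ z₀`, being a nonzero scalar plus a nilpotent.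
  refine ⟨P, N, fun z => Ring.inverse (Aop z),
    fun z => Ring.inverse ((1 - z * l) • 1 - z • N), hPP, hfd, hrange, ?_, ?_⟩
  · obtain ⟨a, ha⟩ := hA0
    have h1 : ContinuousAt Ring.inverse (Aop z₀) := by
      rw [← ha]
      exact NormedRing.inverse_continuousAt a
    exact h1.comp hAc.continuousAt
  have hAev : ∀ᶠ z in 𝓝[≠] z₀, IsUnit (Aop z) :=
    nhdsWithin_le_nhds (hAc.continuousAt.eventually (Units.isOpen.mem_nhds hA0))
  filter_upwards [hAev, self_mem_nhdsWithin] with z hAz hz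
  have hz' : z ≠ z₀ := hz
  have hg : 1 - z * l ≠ 0 := by
    intro h
    apply hz'
    rw [hl] at h
    field_simp at h
    linear_combination -h
  have hCunit : IsUnit ((1 - z * l) • (1 : H →L[ℂ] H) - z • N) := by
    rw [sub_eq_add_neg]
    refine IsNilpotent.isUnit_add_left_of_commute (hnil.smul z).neg ?_ ?_
    · simpa [Algebra.algebraMap_eq_smul_one] using
        (IsUnit.mk0 _ hg).map (algebraMap ℂ (H →L[ℂ] H))
    · exact (Commute.one_right _).smul_right _
  obtain ⟨a, ha⟩ := hAz
  obtain ⟨c, hc⟩ := hCunit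
  rw [← ha, ← hc, Ring.inverse_unit, Ring.inverse_unit]
  have hTa : Commute T (a : H →L[ℂ] H) := by
    rw [ha]
    exact (Commute.one_right T).sub_right
      (((Commute.refl T).mul_right ((Commute.one_right T).sub_right hPT.symm)).smul_right z)
  have hPa : Commute P (a : H →L[ℂ] H) := by
    rw [ha]
    exact (Commute.one_right P).sub_right
      ((hPT.mul_right ((Commute.one_right P).sub_right (Commute.refl P))).smul_right z)
  have hTc : Commute T (c : H →L[ℂ] H) := by
    rw [hc]
    exact ((Commute.one_right T).smul_right _).sub_right (hTN.smul_right z)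
  have hPc : Commute P (c : H →L[ℂ] H) := by
    rw [hc]
    exact ((Commute.one_right P).smul_right _).sub_right (hPN.smul_right z)
  have hNc : Commute N (c : H →L[ℂ] H) := by
    rw [hc]
    exact ((Commute.one_right N).smul_right _).sub_right ((Commute.refl N).smul_right z)
  have hTa' := hTa.units_inv_right
  have hPa' := hPa.units_inv_right
  have hTc' := hTc.units_inv_right
  have hPc' := hPc.units_inv_right
  have hNc' := hNc.units_inv_right
  set R : H →L[ℂ] H := ↑a⁻¹ * (1 - P) + ↑c⁻¹ * P with hR
  have h1 : (1 - z • T) * (1 - P) = a * (1 - P) := by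
    rw [ha, hAop]
    simp only [sub_mul, one_mul, mul_sub, mul_one, smul_mul_assoc, mul_assoc, hPP]
    simp only [sub_self, smul_zero, sub_zero, smul_sub]
    abel
  have h2 : (1 - z • T) * P = c * P := by
    simp only [hc, sub_mul, smul_mul_assoc, one_mul, hNP]
    simp only [hN, sub_mul, smul_mul_assoc, one_mul]
    module
  have hmul : (1 - z • T) * R = 1 := by
    have e1 : (↑a⁻¹ : H →L[ℂ] H) * (1 - P) = (1 - P) * ↑a⁻¹ :=
      ((Commute.one_right _).sub_right hPa'.symm).eq
    rw [hR, mul_add, e1, ← hPc'.eq, ← mul_assoc, ← mul_assoc, h1, h2, mul_assoc, ← e1, mul_assoc,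
      hPc'.eq, Units.mul_inv_cancel_left, Units.mul_inv_cancel_left, sub_add_cancel]
  have hcomm : Commute (1 - z • T) R := by
    have : Commute T R :=
      (hTa'.mul_right ((Commute.one_right T).sub_right hPT.symm)).add_right
        (hTc'.mul_right hPT.symm)
    exact (Commute.one_left R).sub_left (this.smul_left z)
  have hunit : IsUnit (1 - z • T) := ⟨⟨1 - z • T, R, hmul, hcomm.eq ▸ hmul⟩, rfl⟩
  refine ⟨hunit, ?_, ?_, ?_⟩
  · exact ((Ring.inverse_mul_cancel_left _ R hunit).symm.trans (by rw [hmul, mul_one])).symm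
  · rw [hPN']
    exact hNc'.isNilpotent_mul_right hnil
  · rw [hPN']
    have hTP : T * P = l • P + N := by
      rw [hN, sub_mul, smul_mul_assoc, one_mul]
      abel
    have hW : (1 - z * l) • ((↑c⁻¹ : H →L[ℂ] H) * P) = P + z • (N * ↑c⁻¹) := by
      have e : (c : H →L[ℂ] H) * (↑c⁻¹ * P) = P := Units.mul_inv_cancel_left _ _
      rw [hc, sub_mul, smul_mul_assoc, smul_mul_assoc, one_mul, ← hPc'.eq, ← mul_assoc, hNP,
        hPc'.eq, sub_eq_iff_eq_add] at e
      exact e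
    have hzz : (z₀ - z) ≠ 0 := sub_ne_zero.2 (Ne.symm hz')
    have hinv : (z₀ - z)⁻¹ = l * (1 - z * l)⁻¹ := by
      rw [hl]
      rw [hl] at hg
      field_simp
    have hW' : (↑c⁻¹ : H →L[ℂ] H) * P = (1 - z * l)⁻¹ • (P + z • (N * ↑c⁻¹)) := by
      rw [← hW, smul_smul, inv_mul_cancel₀ hg, one_smul]
    calc T * (↑c⁻¹ * P) = ↑c⁻¹ * (T * P) := by rw [← mul_assoc, hTc'.eq, mul_assoc]
      _ = l • (↑c⁻¹ * P) + N * ↑c⁻¹ := by rw [hTP, mul_add, mul_smul_comm, hNc'.eq]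
      _ = _ := by
        rw [hW', hinv]
        module

/-- The residue at `z₀`. The part of the inverse off the generalized eigenspace stays bounded; on
it, the nilpotent term has trace zero and `(z₀ - z)⁻¹ • P` has trace `(z₀ - z)⁻¹` times the
dimension. -/
theorem tendsto_sub_mul_operatorTrace_inverse {T : H →L[ℂ] H} (hT : IsTraceClassOperator T)
    {φ : (H →L[ℂ] H) →L[ℂ] ℂ} (hφ : ∀ R, φ R = operatorTrace (T * R)) {z₀ : ℂ} (hz₀ : z₀ ≠ 0) :
    Tendsto (fun z => (z - z₀) * φ (Ring.inverse (1 - z • T))) (𝓝[≠] z₀)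
      (𝓝 (-(Module.finrank ℂ (Module.End.maxGenEigenspace (T : H →ₗ[ℂ] H) z₀⁻¹) : ℂ))) := by
  obtain ⟨P, N, G, W, hPP, hfd, hrange, hG, hev⟩ :=
    exists_inverse_one_sub_smul_decomposition hT.isCompactOperator hz₀
  obtain ⟨hP1, hP2⟩ := operatorTrace_eq_finrank_of_isIdempotent hPP
  rw [← hrange]
  have h1 : Tendsto (fun z => (z - z₀) * φ (G z * (1 - P)) + -(Module.finrank ℂ P.range : ℂ))
      (𝓝 z₀) (𝓝 (-(Module.finrank ℂ P.range : ℂ))) := by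
    have hc : ContinuousAt (fun z => (z - z₀) * φ (G z * (1 - P)) +
        -(Module.finrank ℂ P.range : ℂ)) z₀ := by fun_prop
    have := hc.tendsto
    simpa using this
  refine (h1.mono_left nhdsWithin_le_nhds).congr' ?_
  filter_upwards [hev, self_mem_nhdsWithin] with z hz hne
  obtain ⟨-, h2, h3, h4⟩ := hz
  have hzz : z - z₀ ≠ 0 := sub_ne_zero.2 hne
  have hzz' : z₀ - z ≠ 0 := sub_ne_zero.2 (Ne.symm hne)
  have hmem : ∀ x, (P * N * W z) x ∈ P.range := fun x => ⟨N (W z x), rfl⟩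
  have h5 := (operatorTrace_eq_trace_restrict hmem).1
  rw [h2, map_add, hφ (W z * P), h4, operatorTrace_add (nuclear_smul _ hP1) (nuclear_smul _ h5),
    operatorTrace_smul _ hP1, operatorTrace_smul _ h5,
    operatorTrace_eq_zero_of_isNilpotent hmem h3, hP2, mul_add]
  have : (z - z₀) * (z₀ - z)⁻¹ = -1 := by
    rw [← neg_sub z₀ z, neg_mul, mul_inv_cancel₀ hzz']
  linear_combination -(Module.finrank ℂ P.range : ℂ) * this

theorem eventually_isUnit_one_sub_smul {T : H →L[ℂ] H} (hT : IsCompactOperator T) (z₀ : ℂ) :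
    ∀ᶠ z in 𝓝[≠] z₀, IsUnit (1 - z • T) := by
  rcases eq_or_ne z₀ 0 with rfl | hz₀
  · have hc : ContinuousAt (fun z : ℂ => 1 - z • T) 0 := by fun_prop
    refine nhdsWithin_le_nhds (hc.eventually (Units.isOpen.mem_nhds ?_))
    simp
  · obtain ⟨_, _, _, _, _, _, _, _, hev⟩ := exists_inverse_one_sub_smul_decomposition hT hz₀
    exact hev.mono fun z hz => hz.1

/-- The singular points are isolated, and a discrete subset of the plane is countable. -/
theorem countable_setOf_not_isUnit_one_sub_smul {T : H →L[ℂ] H} (hT : IsCompactOperator T) :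
    {z : ℂ | ¬ IsUnit (1 - z • T)}.Countable := by
  refine (HereditarilyLindelofSpace.isLindelof _).countable ?_
  rw [← isDiscrete_iff_discreteTopology]
  refine IsDiscrete.of_nhdsWithin fun z _ => ?_
  rw [nhdsWithin, le_pure_iff]
  have h := eventually_isUnit_one_sub_smul hT z
  rw [eventually_nhdsWithin_iff] at h
  filter_upwards [mem_inf_of_left h, mem_inf_of_right (mem_principal_self _)] with w hw hw'
  by_contra hne
  exact hw' (hw hne)

theorem analyticAt_inverse_one_sub_smul (T : H →L[ℂ] H) (φ : (H →L[ℂ] H) →L[ℂ] ℂ) {z : ℂ}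
    (hz : IsUnit (1 - z • T)) :
    AnalyticAt ℂ (fun w => φ (Ring.inverse (1 - w • T))) z := by
  obtain ⟨a, ha⟩ := hz
  have h1 : AnalyticAt ℂ Ring.inverse (1 - z • T) := by
    rw [← ha]
    exact analyticAt_inverse a
  have h2 : AnalyticAt ℂ (fun w : ℂ => 1 - w • T) z := by fun_prop
  exact (φ.analyticAt _).comp
    (AnalyticAt.comp (g := Ring.inverse) (f := fun w : ℂ => 1 - w • T) h1 h2)

/-- The Neumann series of `(1 - z T)⁻¹`, with the continuous functional `φ` applied term by term. -/
theorem eventually_hasSum_operatorTrace_inverse {T : H →L[ℂ] H}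
    {φ : (H →L[ℂ] H) →L[ℂ] ℂ} (hφ : ∀ R, φ R = operatorTrace (T * R)) :
    ∀ᶠ z in 𝓝 (0 : ℂ), HasSum (fun m : ℕ => z ^ m * operatorTrace (T ^ (m + 1)))
      (φ (Ring.inverse (1 - z • T))) := by
  have hc : ContinuousAt (fun z : ℂ => ‖z • T‖) 0 := by fun_prop
  have hev : ∀ᶠ z in 𝓝 (0 : ℂ), ‖z • T‖ < 1 :=
    hc.eventually (gt_mem_nhds (by simp))
  filter_upwards [hev] with z hz
  rw [NormedRing.inverse_one_sub _ hz]
  have h := (summable_geometric_of_norm_lt_one hz).hasSum.mapL φ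
  convert! h using 1
  ext m
  rw [smul_pow, map_smul, hφ, pow_succ', smul_eq_mul]

/-- Trace class operators whose powers of order at least two have equal traces have the same
nonzero eigenvalues with the same algebraic multiplicities. -/
theorem eigenvalueMultiplicity_eq_of_operatorTrace_pow_eq {H' : Type*} [NormedAddCommGroup H']
    [InnerProductSpace ℂ H'] [CompleteSpace H'] {T : H →L[ℂ] H} {T' : H' →L[ℂ] H'}
    (hT : IsTraceClassOperator T) (hT' : IsTraceClassOperator T')
    (h : ∀ m, 2 ≤ m → operatorTrace (T ^ m) = operatorTrace (T' ^ m)) :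
    eigenvalueMultiplicity T = eigenvalueMultiplicity T' := by
  obtain ⟨φ, hφ⟩ := exists_continuousLinearMap_operatorTrace_mul hT
  obtain ⟨φ', hφ'⟩ := exists_continuousLinearMap_operatorTrace_mul hT'
  set c := operatorTrace T - operatorTrace T' with hc
  set U : Set ℂ := ({z | ¬ IsUnit (1 - z • T)} ∪ {z | ¬ IsUnit (1 - z • T')})ᶜ with hU
  have hUmem : ∀ z, z ∈ U ↔ IsUnit (1 - z • T) ∧ IsUnit (1 - z • T') := fun z => by
    simp [hU]
  -- The complement of a countable set in the real plane is connected.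
  have hconn : IsPreconnected U :=
    (((countable_setOf_not_isUnit_one_sub_smul hT.isCompactOperator).union
      (countable_setOf_not_isUnit_one_sub_smul hT'.isCompactOperator)
      ).isConnected_compl_of_one_lt_rank (by simp)).isPreconnected
  -- Near `0` the two power series differ only in the constant term, by `c`. The identity theorem
  -- extends this to `U`.
  have hzero : Set.EqOn (fun z => φ (Ring.inverse (1 - z • T)) - φ' (Ring.inverse (1 - z • T')) - c)
      0 U := by
    refine AnalyticOnNhd.eqOn_zero_of_preconnected_of_eventuallyEq_zero (𝕜 := ℂ) (z₀ := 0)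
      (fun z hz => ?_) hconn ((hUmem 0).2 (by simp)) ?_
    · obtain ⟨h1, h2⟩ := (hUmem z).1 hz
      exact ((analyticAt_inverse_one_sub_smul T φ h1).sub
        (analyticAt_inverse_one_sub_smul T' φ' h2)).sub analyticAt_const
    · filter_upwards [eventually_hasSum_operatorTrace_inverse hφ,
        eventually_hasSum_operatorTrace_inverse hφ'] with z h1 h2
      have h3 := h1.sub h2
      have h4 : HasSum (fun m : ℕ => z ^ m * operatorTrace (T ^ (m + 1)) -
          z ^ m * operatorTrace (T' ^ (m + 1))) c := by
        have h5 := hasSum_single (f := fun m : ℕ => z ^ m * operatorTrace (T ^ (m + 1)) -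
          z ^ m * operatorTrace (T' ^ (m + 1))) 0
          (fun m hm => by rw [h (m + 1) (by omega), sub_self])
        simpa [hc] using h5
      simp [h3.unique h4]
  ext ⟨l, hl⟩
  have hl' : l⁻¹ ≠ 0 := inv_ne_zero hl
  have h1 := tendsto_sub_mul_operatorTrace_inverse hT hφ hl'
  have h2 := tendsto_sub_mul_operatorTrace_inverse hT' hφ' hl'
  rw [inv_inv] at h1 h2
  -- The constant `c` contributes no residue, so the unknown first moments do no harm.
  have h3 : Tendsto (fun z : ℂ => (z - l⁻¹) * c) (𝓝[≠] l⁻¹) (𝓝 0) := by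
    have hcont : ContinuousAt (fun z : ℂ => (z - l⁻¹) * c) l⁻¹ := by fun_prop
    simpa using hcont.tendsto.mono_left nhdsWithin_le_nhds
  have h4 := (h1.sub h2).sub h3
  have h5 : Tendsto (fun _ : ℂ => (0 : ℂ)) (𝓝[≠] l⁻¹) (𝓝 _) := h4.congr' (by
    filter_upwards [eventually_isUnit_one_sub_smul hT.isCompactOperator l⁻¹,
      eventually_isUnit_one_sub_smul hT'.isCompactOperator l⁻¹] with z e1 e2
    have := hzero ((hUmem z).2 ⟨e1, e2⟩)
    simp only [Pi.zero_apply] at this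
    linear_combination (z - l⁻¹) * this)
  have h6 := tendsto_nhds_unique h5 tendsto_const_nhds
  rw [sub_zero, sub_eq_zero, neg_inj] at h6
  exact_mod_cast h6

end TraceResolvent

/-! ### Total extensions of tracial weights -/

section Extension

open scoped ComplexOrder

variable {A : Type*} [Ring A] [StarRing A] [Algebra ℂ A]

/-- A linear extension from a subspace always exists. Its values off the domain are meaningless, but
moments can be written without membership proofs inside the terms. -/
theorem TracialWeight.exists_extension (ω : TracialWeight A) :
    ∃ g : A →ₗ[ℂ] ℂ, ∀ (x : A) (hx : x ∈ ω.domain), g x = ω.toFun ⟨x, hx⟩ := by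
  obtain ⟨g, hg⟩ := LinearMap.exists_extend (p := ω.domain.toNonUnitalSubalgebra.toSubmodule)
    ω.toFun
  exact ⟨g, fun x hx => LinearMap.congr_fun hg ⟨x, hx⟩⟩

/-- A linear functional on the whole algebra that extends a tracial weight. -/
noncomputable def TracialWeight.extend (ω : TracialWeight A) : A →ₗ[ℂ] ℂ :=
  ω.exists_extension.choose

theorem TracialWeight.extend_apply (ω : TracialWeight A) {x : A} (hx : x ∈ ω.domain) :
    ω.extend x = ω.toFun ⟨x, hx⟩ :=
  ω.exists_extension.choose_spec x hx

theorem TracialWeight.extend_mul_comm (ω : TracialWeight A) {x y : A} (hx : x ∈ ω.domain)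
    (hy : y ∈ ω.domain) : ω.extend (x * y) = ω.extend (y * x) := by
  rw [ω.extend_apply (mul_mem hx hy), ω.extend_apply (mul_mem hy hx)]
  exact ω.tracial ⟨x, hx⟩ ⟨y, hy⟩

theorem TracialWeight.extend_star (ω : TracialWeight A) {x : A} (hx : x ∈ ω.domain) :
    ω.extend (star x) = star (ω.extend x) := by
  rw [ω.extend_apply hx, ω.extend_apply (star_mem hx)]
  exact ω.selfadjoint ⟨x, hx⟩

theorem TracialWeight.extend_star_mul_self_nonneg (ω : TracialWeight A) {x : A}
    (hx : x ∈ ω.domain) : 0 ≤ ω.extend (star x * x) := by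
  rw [ω.extend_apply (mul_mem (star_mem hx) hx)]
  exact ω.positive ⟨x, hx⟩

theorem TracialWeight.matrix_extend (ω : TracialWeight A) {n : Type*} [Fintype n] [DecidableEq n]
    {M : Matrix n n A} (hM : ∀ i j, M i j ∈ ω.domain) :
    (ω.matrix n).extend M = ∑ i, ω.extend (M i i) := by
  rw [(ω.matrix n).extend_apply (x := M) hM]
  exact Finset.sum_congr rfl fun i _ => (ω.extend_apply (hM i i)).symm

theorem foldl_mul_eq_mul_prod {M ι : Type*} [Monoid M] (f : ι → M) (w : List ι) (x : M) :
    w.foldl (fun x q => x * f q) x = x * (w.map f).prod := by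
  induction w generalizing x with
  | nil => simp
  | cons q w ih => simp [ih, mul_assoc]

theorem TracialWeight.moment_eq_extend_prod (ω : TracialWeight A) {ι : Type*} (a : ι → A)
    (ha : ∀ i, a i ∈ ω.domain) (p : ι × Bool) (w : List (ι × Bool)) :
    ω.moment (fun i => ⟨a i, ha i⟩) p w = ω.extend (((p :: w).map (starLetter a)).prod) := by
  have hcoe : ∀ q : ι × Bool,
      ((starLetter (fun i => (⟨a i, ha i⟩ : ω.domain)) q : ω.domain) : A) = starLetter a q := by
    rintro ⟨i, _ | _⟩ <;> rfl
  have h : ∀ (w : List (ι × Bool)) (x : ω.domain),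
      ((w.foldl (fun x q => x * starLetter (fun i => (⟨a i, ha i⟩ : ω.domain)) q) x : ω.domain) : A)
        = w.foldl (fun x q => x * starLetter a q) (x : A) := by
    intro w
    induction w with
    | nil => exact fun x => rfl
    | cons q w ih =>
      intro x
      rw [List.foldl_cons, List.foldl_cons, ih, ← hcoe q]
      rfl
  rw [TracialWeight.moment, ← ω.extend_apply (Subtype.property _), h, hcoe, foldl_mul_eq_mul_prod,
    List.map_cons, List.prod_cons]

theorem sameDistribution_iff_extend {B ι : Type*} [Ring B] [StarRing B] [Algebra ℂ B]
    {ω : TracialWeight A} {ψ : TracialWeight B} {a : ι → A} {b : ι → B}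
    (ha : ∀ i, a i ∈ ω.domain) (hb : ∀ i, b i ∈ ψ.domain) :
    SameDistribution ω (fun i => ⟨a i, ha i⟩) ψ (fun i => ⟨b i, hb i⟩) ↔
      ∀ l : List (ι × Bool), l ≠ [] →
        ω.extend ((l.map (starLetter a)).prod) = ψ.extend ((l.map (starLetter b)).prod) := by
  constructor
  · intro h l hl
    obtain ⟨p, w, rfl⟩ := List.exists_cons_of_ne_nil hl
    rw [← ω.moment_eq_extend_prod a ha, ← ψ.moment_eq_extend_prod b hb]
    exact h p w
  · intro h p w
    rw [ω.moment_eq_extend_prod a ha, ψ.moment_eq_extend_prod b hb]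
    exact h _ (List.cons_ne_nil _ _)

end Extension

/-! ### Nonempty products and generated algebras -/

section ListProducts

theorem list_prod_mem_of_ne_nil {M S : Type*} [Monoid M] [SetLike S M] [MulMemClass S M] (s : S)
    {l : List M} (hl : l ≠ []) (h : ∀ x ∈ l, x ∈ s) : l.prod ∈ s := by
  induction l with
  | nil => exact absurd rfl hl
  | cons x l ih =>
    rw [List.prod_cons]
    rcases eq_or_ne l [] with rfl | hl'
    · simpa using h x (by simp)
    · exact mul_mem (h x (by simp)) (ih hl' fun y hy => h y (by simp [hy]))

theorem exists_list_map_prod_of_mem_closure_range {M κ : Type*} [Monoid M] {f : κ → M} {x : M}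
    (hx : x ∈ Subsemigroup.closure (Set.range f)) :
    ∃ l : List κ, l ≠ [] ∧ (l.map f).prod = x := by
  induction hx using Subsemigroup.closure_induction with
  | mem x hx =>
    obtain ⟨k, rfl⟩ := hx
    exact ⟨[k], by simp, by simp⟩
  | mul x y _ _ hx hy =>
    obtain ⟨l, hl, rfl⟩ := hx
    obtain ⟨l', hl', rfl⟩ := hy
    exact ⟨l ++ l', by simp [hl], by simp⟩

/-- A non-unital algebra is spanned by nonempty words in its generators. Linear identities between
functionals therefore need only be checked on words. -/
theorem forall_mem_adjoin_range_of_list_prod {R κ : Type*} [Ring R] [Algebra ℂ R] {f : κ → R}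
    (V : Submodule ℂ R) (h : ∀ l : List κ, l ≠ [] → (l.map f).prod ∈ V) {x : R}
    (hx : x ∈ NonUnitalAlgebra.adjoin ℂ (Set.range f)) : x ∈ V := by
  have h1 : x ∈ Submodule.span ℂ (Subsemigroup.closure (Set.range f) : Set R) := by
    rw [← NonUnitalAlgebra.adjoin_eq_span]
    exact hx
  refine Submodule.span_le.2 (fun y hy => ?_) h1
  obtain ⟨l, hl, rfl⟩ := exists_list_map_prod_of_mem_closure_range hy
  exact h l hl

theorem mem_adjoin_range_starLetter_of_mem_adjoin {R ι : Type*} [Ring R] [StarRing R] [Algebra ℂ R]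
    [StarModule ℂ R] {a : ι → R} {x : R}
    (hx : x ∈ NonUnitalStarAlgebra.adjoin ℂ (Set.range a)) :
    x ∈ NonUnitalAlgebra.adjoin ℂ (Set.range (starLetter a)) := by
  have h1 : x ∈ NonUnitalAlgebra.adjoin ℂ (Set.range a ∪ star (Set.range a)) := by
    rw [← NonUnitalStarAlgebra.adjoin_toNonUnitalSubalgebra]
    exact hx
  refine NonUnitalAlgebra.adjoin_mono ?_ h1
  rintro y (⟨i, rfl⟩ | hy)
  · exact ⟨(i, false), rfl⟩
  · obtain ⟨i, hi⟩ := hy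
    exact ⟨(i, true), by rw [starLetter, if_pos rfl, hi, star_star]⟩

end ListProducts

/-! ### Matrices with corresponding entries -/

section PairedEntries

variable {R R' : Type*} [Ring R] [Algebra ℂ R] [Ring R'] [Algebra ℂ R'] {n : Type*} [Fintype n]

/-- The pairs of corresponding entries of two matrices lie in a given set. -/
def PairedEntries {S : Type*} [SetLike S (R × R')] (E : S) (M : Matrix n n R) (M' : Matrix n n R') :
    Prop :=
  ∀ i j, (M i j, M' i j) ∈ E

theorem PairedEntries.mul {E : NonUnitalSubalgebra ℂ (R × R')} {M N : Matrix n n R}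
    {M' N' : Matrix n n R'} (hM : PairedEntries E M M') (hN : PairedEntries E N N') :
    PairedEntries E (M * N) (M' * N') := by
  intro i j
  have h : ((M * N) i j, (M' * N') i j) = ∑ l, (M i l, M' i l) * (N l j, N' l j) := by
    rw [Prod.ext_iff, Prod.fst_sum, Prod.snd_sum]
    exact ⟨Matrix.mul_apply, Matrix.mul_apply⟩
  rw [h]
  exact sum_mem fun l _ => mul_mem (hM i l) (hN l j)

theorem PairedEntries.list_prod [DecidableEq n] {E : NonUnitalSubalgebra ℂ (R × R')} {κ : Type*}
    {f : κ → Matrix n n R} {f' : κ → Matrix n n R'} {l : List κ} (hl : l ≠ [])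
    (h : ∀ p ∈ l, PairedEntries E (f p) (f' p)) :
    PairedEntries E (l.map f).prod (l.map f').prod := by
  induction l with
  | nil => exact absurd rfl hl
  | cons p l ih =>
    rcases eq_or_ne l [] with rfl | hl'
    · simpa using h p (by simp)
    · rw [List.map_cons, List.map_cons, List.prod_cons, List.prod_cons]
      exact (h p (by simp)).mul (ih hl' fun q hq => h q (by simp [hq]))

/-- The algebra `E` is not unital, so scalar matrices need not be paired over it; multiplying by
them only forms linear combinations of entries. -/
theorem PairedEntries.mul_map_algebraMap {E : NonUnitalSubalgebra ℂ (R × R')} {M : Matrix n n R}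
    {M' : Matrix n n R'} (hM : PairedEntries E M M') (c : Matrix n n ℂ) :
    PairedEntries E (M * c.map (algebraMap ℂ R)) (M' * c.map (algebraMap ℂ R')) := by
  intro i j
  have h : ((M * c.map (algebraMap ℂ R)) i j, (M' * c.map (algebraMap ℂ R')) i j) =
      ∑ l, c l j • (M i l, M' i l) := by
    rw [Prod.ext_iff, Prod.fst_sum, Prod.snd_sum]
    constructor
    · simp [Matrix.mul_apply, Algebra.smul_def, Algebra.commutes]
    · simp [Matrix.mul_apply, Algebra.smul_def, Algebra.commutes]
  rw [h]
  exact sum_mem fun l _ => SMulMemClass.smul_mem _ (hM i l)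

theorem PairedEntries.star [StarRing R] [StarRing R'] {G : NonUnitalStarSubalgebra ℂ (R × R')}
    {M : Matrix n n R} {M' : Matrix n n R'} (hM : PairedEntries G M M') :
    PairedEntries G (star M) (star M') :=
  fun i j => star_mem (s := G) (hM j i)

end PairedEntries

/-! ### Matrices of operators as operators on a direct sum -/

section OperatorMatrix

open scoped InnerProductSpace

variable {H : Type*} [NormedAddCommGroup H] [InnerProductSpace ℂ H] [CompleteSpace H]
  {ι : Type*} [Fintype ι] [DecidableEq ι]

theorem adjoint_piLp_proj_apply (j : ι) (x : H) :
    (PiLp.proj 2 (𝕜 := ℂ) (fun _ : ι => H) j).adjoint x = WithLp.toLp 2 (Pi.single j x) := by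
  refine ext_inner_right ℂ fun y => ?_
  rw [ContinuousLinearMap.adjoint_inner_left, PiLp.inner_apply,
    Finset.sum_eq_single j (fun k _ hk => by simp [hk]) (by simp)]
  simp

/-- The operator on `H ^ ι` given by a matrix of operators on `H`. -/
noncomputable def operatorMatrix (M : Matrix ι ι (H →L[ℂ] H)) :
    PiLp 2 (fun _ : ι => H) →L[ℂ] PiLp 2 (fun _ : ι => H) :=
  ∑ i, ∑ j, (PiLp.proj 2 (𝕜 := ℂ) (fun _ : ι => H) i).adjoint ∘L M i j ∘L
    PiLp.proj 2 (𝕜 := ℂ) (fun _ : ι => H) j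

theorem operatorMatrix_apply (M : Matrix ι ι (H →L[ℂ] H)) (x : PiLp 2 (fun _ : ι => H)) (i : ι) :
    operatorMatrix M x i = ∑ j, M i j (x j) := by
  simp only [operatorMatrix, sum_apply, ContinuousLinearMap.comp_apply,
    adjoint_piLp_proj_apply, PiLp.proj_apply]
  simp [Pi.single_apply]

theorem operatorMatrix_one : operatorMatrix (1 : Matrix ι ι (H →L[ℂ] H)) = 1 := by
  ext x i
  rw [operatorMatrix_apply, Finset.sum_eq_single i (fun j _ hj => by simp [hj.symm]) (by simp)]
  simp

theorem operatorMatrix_mul (M N : Matrix ι ι (H →L[ℂ] H)) :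
    operatorMatrix (M * N) = operatorMatrix M * operatorMatrix N := by
  ext x i
  simp only [operatorMatrix_apply, mul_apply_eq_comp, Matrix.mul_apply, sum_apply, map_sum]
  exact Finset.sum_comm

theorem operatorMatrix_star (M : Matrix ι ι (H →L[ℂ] H)) :
    operatorMatrix (star M) = star (operatorMatrix M) := by
  rw [ContinuousLinearMap.star_eq_adjoint, ContinuousLinearMap.eq_adjoint_iff]
  intro x y
  simp only [PiLp.inner_apply, operatorMatrix_apply, sum_inner, inner_sum, Matrix.star_apply,
    ContinuousLinearMap.star_eq_adjoint, ContinuousLinearMap.adjoint_inner_left]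
  exact Finset.sum_comm

/-- A nuclear series for `T` embeds into the summands `j` and `i`. The inner products of its vectors
survive only when the summands coincide, so off-diagonal blocks have trace zero. -/
theorem isTraceClassOperator_adjoint_proj_comp_comp_proj {T : H →L[ℂ] H}
    (hT : IsTraceClassOperator T) (i j : ι) :
    IsTraceClassOperator ((PiLp.proj 2 (𝕜 := ℂ) (fun _ : ι => H) i).adjoint ∘L T ∘L
      PiLp.proj 2 (𝕜 := ℂ) (fun _ : ι => H) j) ∧
    operatorTrace ((PiLp.proj 2 (𝕜 := ℂ) (fun _ : ι => H) i).adjoint ∘L T ∘L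
      PiLp.proj 2 (𝕜 := ℂ) (fun _ : ι => H) j) = if i = j then operatorTrace T else 0 := by
  obtain ⟨u, v, hs, h⟩ := hT
  set p := fun j => PiLp.proj 2 (𝕜 := ℂ) (fun _ : ι => H) j with hp
  have h1 : Summable fun m => ‖(p j).adjoint (u m)‖ * ‖(p i).adjoint (v m)‖ := by
    refine Summable.of_nonneg_of_le (fun m => by positivity) (fun m => ?_)
      (hs.mul_left (‖(p j).adjoint‖ * ‖(p i).adjoint‖))
    calc _ ≤ (‖(p j).adjoint‖ * ‖u m‖) * (‖(p i).adjoint‖ * ‖v m‖) :=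
          mul_le_mul ((p j).adjoint.le_opNorm _) ((p i).adjoint.le_opNorm _) (norm_nonneg _)
            (by positivity)
      _ = _ := by ring
  have h2 : ∀ x, HasSum (fun m => ⟪(p j).adjoint (u m), x⟫_ℂ • (p i).adjoint (v m))
      (((p i).adjoint ∘L T ∘L p j) x) := fun x => by
    simpa [ContinuousLinearMap.adjoint_inner_left] using (h (p j x)).mapL (p i).adjoint
  refine ⟨⟨_, _, h1, h2⟩, ?_⟩
  rw [operatorTrace_eq_of_nuclear h1 h2, operatorTrace_eq_of_nuclear hs h]
  have h3 : ∀ m, ⟪(p j).adjoint (u m), (p i).adjoint (v m)⟫_ℂ =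
      if i = j then ⟪u m, v m⟫_ℂ else 0 := fun m => by
    rw [ContinuousLinearMap.adjoint_inner_left, adjoint_piLp_proj_apply]
    rcases eq_or_ne i j with rfl | hij
    · simp [hp]
    · simp [hp, hij, hij.symm]
  simp only [h3]
  split_ifs <;> simp

theorem operatorMatrix_mem_domain {M : Matrix ι ι (H →L[ℂ] H)}
    (hM : ∀ i j, M i j ∈ (hilbertTrace H).domain) :
    operatorMatrix M ∈ (hilbertTrace (PiLp 2 fun _ : ι => H)).domain :=
  (isTraceClassOperator_sum _ fun i _ => (isTraceClassOperator_sum _ fun j _ =>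
    (isTraceClassOperator_adjoint_proj_comp_comp_proj (hM i j) i j).1).1).1

theorem hilbertTrace_extend_operatorMatrix {M : Matrix ι ι (H →L[ℂ] H)}
    (hM : ∀ i j, M i j ∈ (hilbertTrace H).domain) :
    (hilbertTrace (PiLp 2 fun _ : ι => H)).extend (operatorMatrix M) =
      ((hilbertTrace H).matrix ι).extend M := by
  rw [TracialWeight.matrix_extend _ hM, TracialWeight.extend_apply _ (operatorMatrix_mem_domain hM)]
  have h1 := fun i j => isTraceClassOperator_adjoint_proj_comp_comp_proj (hM i j) i j
  have h2 := fun i => isTraceClassOperator_sum Finset.univ fun j _ => (h1 i j).1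
  refine (isTraceClassOperator_sum Finset.univ fun i _ => (h2 i).1).2.trans ?_
  refine Finset.sum_congr rfl fun i _ => (h2 i).2.trans ?_
  rw [Finset.sum_congr rfl fun j _ => (h1 i j).2, TracialWeight.extend_apply _ (hM i i)]
  simp
  rfl

/-- A family with the distribution of a family of matrices of trace class operators on a separable
Hilbert space is a trace class family; the operators can be taken to be those given by the
matrices. -/
theorem sameDistribution_operatorMatrix {A : Type*} [Ring A] [StarRing A] [Algebra ℂ A]
    {ω : TracialWeight A} {κ : Type*} {a : κ → A} (ha : ∀ i, a i ∈ ω.domain)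
    {M : κ → Matrix ι ι (H →L[ℂ] H)} (hM : ∀ k i j, M k i j ∈ (hilbertTrace H).domain)
    (h : ∀ l : List (κ × Bool), l ≠ [] → ω.extend ((l.map (starLetter a)).prod) =
      ((hilbertTrace H).matrix ι).extend ((l.map (starLetter M)).prod)) :
    SameDistribution ω (fun i => ⟨a i, ha i⟩) (hilbertTrace (PiLp 2 fun _ : ι => H))
      (fun k => ⟨operatorMatrix (M k), operatorMatrix_mem_domain (hM k)⟩) := by
  rw [sameDistribution_iff_extend ha (b := fun k => operatorMatrix (M k))]
  intro l hl
  have h1 : ∀ p ∈ l.map (starLetter M), p ∈ ((hilbertTrace H).matrix ι).domain := by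
    intro p hp
    obtain ⟨⟨k, b⟩, -, rfl⟩ := List.mem_map.1 hp
    rcases b with _ | _
    · exact hM k
    · exact star_mem (s := ((hilbertTrace H).matrix ι).domain) (hM k)
  rw [h l hl, ← hilbertTrace_extend_operatorMatrix
    (list_prod_mem_of_ne_nil ((hilbertTrace H).matrix ι).domain (by simpa using hl) h1)]
  congr 1
  let Θ : Matrix ι ι (H →L[ℂ] H) →*
      (PiLp 2 (fun _ : ι => H) →L[ℂ] PiLp 2 (fun _ : ι => H)) :=
    { toFun := operatorMatrix, map_one' := operatorMatrix_one, map_mul' := operatorMatrix_mul }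
  have h2 := map_list_prod Θ (l.map (starLetter M))
  rw [List.map_map] at h2
  refine h2.trans (congrArg List.prod (List.map_congr_left ?_))
  rintro ⟨k, _ | _⟩ -
  · rfl
  · exact operatorMatrix_star (M k)

end OperatorMatrix

/-! ### The ideal of a cyclically monotone pair and positivity of `τ` -/

section CyclicIdeal

open scoped ComplexOrder

variable {C : Type*} [Ring C] [StarRing C] [Algebra ℂ C] [StarModule ℂ C]
  {A : NonUnitalStarSubalgebra ℂ C} {B : StarSubalgebra ℂ C}

theorem mem_cyclicIdeal_of_mem {a : C} (ha : a ∈ A) : a ∈ cyclicIdeal A B :=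
  Submodule.subset_span ⟨1, one_mem B, [(⟨a, ha⟩, ⟨1, one_mem B⟩)], by simp, by simp⟩

theorem mul_mem_cyclicIdeal_left {b s : C} (hb : b ∈ B) (hs : s ∈ cyclicIdeal A B) :
    b * s ∈ cyclicIdeal A B := by
  induction hs using Submodule.span_induction with
  | mem x hx =>
    obtain ⟨b₀, hb₀, l, hl, rfl⟩ := hx
    exact Submodule.subset_span ⟨b * b₀, mul_mem hb hb₀, l, hl, (mul_assoc _ _ _).symm⟩
  | zero => simp
  | add x y _ _ hx hy => rw [mul_add]; exact add_mem hx hy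
  | smul c x _ hx => rw [mul_smul_comm]; exact Submodule.smul_mem _ c hx

theorem mul_mem_cyclicIdeal_right {b s : C} (hb : b ∈ B) (hs : s ∈ cyclicIdeal A B) :
    s * b ∈ cyclicIdeal A B := by
  induction hs using Submodule.span_induction with
  | mem x hx =>
    obtain ⟨b₀, hb₀, l, hl, rfl⟩ := hx
    obtain ⟨l, p, rfl⟩ := (List.eq_nil_or_concat' l).resolve_left hl
    refine Submodule.subset_span ⟨b₀, hb₀, l ++ [(p.1, p.2 * ⟨b, hb⟩)], by simp, ?_⟩
    simp [mul_assoc]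
  | zero => simp
  | add x y _ _ hx hy => rw [add_mul]; exact add_mem hx hy
  | smul c x _ hx => rw [smul_mul_assoc]; exact Submodule.smul_mem _ c hx

theorem mul_mem_cyclicIdeal {s t : C} (hs : s ∈ cyclicIdeal A B) (ht : t ∈ cyclicIdeal A B) :
    s * t ∈ cyclicIdeal A B := by
  induction ht using Submodule.span_induction with
  | mem x hx =>
    obtain ⟨b₀, hb₀, l, hl, rfl⟩ := hx
    rw [← mul_assoc]
    have h := mul_mem_cyclicIdeal_right hb₀ hs
    generalize s * b₀ = y at h ⊢
    induction h using Submodule.span_induction with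
    | mem y hy =>
      obtain ⟨b₁, hb₁, l', hl', h⟩ := hy
      rw [h]
      exact Submodule.subset_span ⟨b₁, hb₁, l' ++ l, by simp [hl], by simp [mul_assoc]⟩
    | zero => simp
    | add x y _ _ hx hy => rw [add_mul]; exact add_mem hx hy
    | smul c x _ hx => rw [smul_mul_assoc]; exact Submodule.smul_mem _ c hx
  | zero => simp
  | add x y _ _ hx hy => rw [mul_add]; exact add_mem hx hy
  | smul c x _ hx => rw [mul_smul_comm]; exact Submodule.smul_mem _ c hx

theorem star_mem_cyclicIdeal {s : C} (hs : s ∈ cyclicIdeal A B) : star s ∈ cyclicIdeal A B := by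
  induction hs using Submodule.span_induction with
  | mem x hx =>
    obtain ⟨b₀, hb₀, l, hl, rfl⟩ := hx
    rw [star_mul]
    refine mul_mem_cyclicIdeal_right (star_mem hb₀) ?_
    induction l with
    | nil => exact absurd rfl hl
    | cons p l ih =>
      have hp : star ((p.1 : C) * (p.2 : C)) ∈ cyclicIdeal A B := by
        rw [star_mul]
        exact mul_mem_cyclicIdeal_left (star_mem p.2.2)
          (mem_cyclicIdeal_of_mem (star_mem p.1.2))
      rw [List.map_cons, List.prod_cons, star_mul]
      rcases eq_or_ne l [] with rfl | hl'
      · simpa using hp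
      · exact mul_mem_cyclicIdeal (ih hl') hp
  | zero => simp
  | add x y _ _ hx hy => rw [star_add]; exact add_mem hx hy
  | smul c x _ hx => rw [star_smul]; exact Submodule.smul_mem _ _ hx

theorem IsCyclicallyMonotone.extend_list_prod {ω : TracialWeight C} {τ : C →ₗ[ℂ] ℂ}
    (h : IsCyclicallyMonotone ω τ A B) {l : List (A × B)} (hl : l ≠ []) :
    ω.extend (l.map fun p => (p.1 : C) * (p.2 : C)).prod =
      ω.extend (l.map fun p => (p.1 : C)).prod * (l.map fun p => τ (p.2 : C)).prod := by
  obtain ⟨h₁, h₂, h₃⟩ := h.2 l hl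
  rw [ω.extend_apply h₁, ω.extend_apply h₂, h₃]

/-- Cyclic monotonicity for the word `a* b a 1`. It recovers `τ b` from `ω` as soon as `ω(a* a) ≠
0`. -/
theorem IsCyclicallyMonotone.extend_star_mul_mul {ω : TracialWeight C} {τ : C →ₗ[ℂ] ℂ}
    (h : IsCyclicallyMonotone ω τ A B) (hτ : τ 1 = 1) {a b : C} (ha : a ∈ A) (hb : b ∈ B) :
    ω.extend (star a * b * a) = ω.extend (star a * a) * τ b := by
  have h1 := h.extend_list_prod (l := [(⟨star a, star_mem ha⟩, ⟨b, hb⟩), (⟨a, ha⟩, ⟨1, one_mem B⟩)])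
    (by simp)
  simpa [hτ] using h1

/-- If `ω` is faithful on the first algebra in a weak sense, then the second functional can be
replaced by a positive one. -/
theorem IsCyclicallyMonotone.exists_positive {ω : TracialWeight C} {τ : C →ₗ[ℂ] ℂ}
    (h : IsCyclicallyMonotone ω τ A B) (hτ : τ 1 = 1)
    (hA : (∀ a ∈ A, ω.extend (star a * a) = 0) → ∀ a ∈ A, ω.extend a = 0) :
    ∃ τ' : C →ₗ[ℂ] ℂ, IsCyclicallyMonotone ω τ' A B ∧ (∀ b ∈ B, τ' (star b) = star (τ' b)) ∧
      ∀ b ∈ B, 0 ≤ τ' (star b * b) := by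
  by_cases hzero : ∀ a ∈ A, ω.extend (star a * a) = 0
  -- Here `ω` vanishes on the first algebra, so both sides of the monotonicity formula are zero
  -- whatever the second functional is; `τ' 1 = 1` is not required.
  · refine ⟨0, ⟨h.1, fun l hl => ?_⟩, by simp, by simp⟩
    obtain ⟨h₁, h₂, h₃⟩ := h.2 l hl
    refine ⟨h₁, h₂, ?_⟩
    have h4 : (l.map fun p => (p.1 : C)).prod ∈ A :=
      list_prod_mem_of_ne_nil A (by simpa using hl) (by
        intro x hx
        obtain ⟨p, -, rfl⟩ := List.mem_map.1 hx
        exact p.1.2)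
    rw [h₃, ← ω.extend_apply h₂, hA hzero _ h4, zero_mul, zero_mul]
  · push Not at hzero
    obtain ⟨a, ha, hne⟩ := hzero
    have haI := mem_cyclicIdeal_of_mem (B := B) ha
    have hpos : 0 < ω.extend (star a * a) :=
      lt_of_le_of_ne (ω.extend_star_mul_self_nonneg (h.1 a haI)) hne.symm
    have hreal : star (ω.extend (star a * a)) = ω.extend (star a * a) :=
      (IsSelfAdjoint.of_nonneg hpos.le)
    refine ⟨τ, h, fun b hb => ?_, fun b hb => ?_⟩
    · have h1 : star a * b * a ∈ ω.domain := h.1 _ (mul_mem_cyclicIdeal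
        (mul_mem_cyclicIdeal_right hb (mem_cyclicIdeal_of_mem (star_mem ha))) haI)
      have h2 := ω.extend_star h1
      rw [h.extend_star_mul_mul hτ ha hb, star_mul', hreal] at h2
      refine mul_left_cancel₀ hne (Eq.trans ?_ h2)
      rw [← h.extend_star_mul_mul hτ ha (star_mem hb)]
      simp [mul_assoc]
    -- Positivity of `ω` at `b a` reads `0 ≤ ω(a* a) τ(b* b)`.
    · have h1 := ω.extend_star_mul_self_nonneg (h.1 _ (mul_mem_cyclicIdeal_left hb haI))
      have h2 := h.extend_star_mul_mul hτ ha (mul_mem (star_mem hb) hb)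
      rw [show star (b * a) * (b * a) = star a * (star b * b) * a by simp [mul_assoc], h2] at h1
      obtain ⟨hre, him⟩ := Complex.pos_iff.1 hpos
      rw [Complex.nonneg_iff] at h1 ⊢
      rw [Complex.mul_re, Complex.mul_im, ← him, zero_mul, zero_mul, sub_zero, add_zero] at h1
      exact ⟨(mul_nonneg_iff_of_pos_left hre).1 h1.1,
        ((mul_eq_zero.1 h1.2.symm).resolve_left hre.ne').symm⟩

end CyclicIdeal

/-! ### Algebras of pairs matching elements with their operator models -/

section PairAlgebras

variable {R R' : Type*} [Ring R] [StarRing R] [Algebra ℂ R] [StarModule ℂ R]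
  [Ring R'] [StarRing R'] [Algebra ℂ R'] [StarModule ℂ R']

/-- The algebra of pairs generated by the pairs of corresponding members of two families. -/
def pairAlgebra {ι : Type*} (a : ι → R) (x : ι → R') : NonUnitalStarSubalgebra ℂ (R × R') :=
  NonUnitalStarAlgebra.adjoin ℂ (Set.range fun i => (a i, x i))

variable {ι : Type*} {a : ι → R} {x : ι → R'}

theorem mem_pairAlgebra (i : ι) : (a i, x i) ∈ pairAlgebra a x :=
  NonUnitalStarAlgebra.subset_adjoin ℂ _ ⟨i, rfl⟩

theorem map_fst_pairAlgebra :
    (pairAlgebra a x).map (NonUnitalStarAlgHom.fst ℂ R R') =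
      NonUnitalStarAlgebra.adjoin ℂ (Set.range a) := by
  rw [pairAlgebra, NonUnitalStarAlgHom.map_adjoin, ← Set.range_comp]
  rfl

theorem map_snd_pairAlgebra :
    (pairAlgebra a x).map (NonUnitalStarAlgHom.snd ℂ R R') =
      NonUnitalStarAlgebra.adjoin ℂ (Set.range x) := by
  rw [pairAlgebra, NonUnitalStarAlgHom.map_adjoin, ← Set.range_comp]
  rfl

theorem fst_mem_of_mem_pairAlgebra {g : R × R'} (hg : g ∈ pairAlgebra a x) :
    g.1 ∈ NonUnitalStarAlgebra.adjoin ℂ (Set.range a) := by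
  rw [← map_fst_pairAlgebra (x := x)]
  exact ⟨g, hg, rfl⟩

theorem snd_mem_of_mem_pairAlgebra {D : NonUnitalStarSubalgebra ℂ R'} (hx : ∀ i, x i ∈ D)
    {g : R × R'} (hg : g ∈ pairAlgebra a x) : g.2 ∈ D := by
  have h : g.2 ∈ NonUnitalStarAlgebra.adjoin ℂ (Set.range x) := by
    rw [← map_snd_pairAlgebra (a := a)]
    exact ⟨g, hg, rfl⟩
  refine (NonUnitalStarAlgebra.adjoin_le ?_ : _ ≤ D) h
  rintro _ ⟨i, rfl⟩
  exact hx i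

theorem exists_mem_pairAlgebra {y : R} (hy : y ∈ NonUnitalStarAlgebra.adjoin ℂ (Set.range a)) :
    ∃ ξ, (y, ξ) ∈ pairAlgebra a x := by
  rw [← map_fst_pairAlgebra (x := x)] at hy
  obtain ⟨⟨_, ξ⟩, hg, rfl⟩ := hy
  exact ⟨ξ, hg⟩

theorem list_map_prod_eq_mk {M M' κ : Type*} [Monoid M] [Monoid M'] (f : κ → M × M') (l : List κ) :
    (l.map f).prod = ((l.map fun i => (f i).1).prod, (l.map fun i => (f i).2).prod) := by
  induction l with
  | nil => rfl
  | cons i l ih =>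
    rw [List.map_cons, List.prod_cons, ih]
    simp [Prod.ext_iff]

variable {ω : TracialWeight R} {ψ : TracialWeight R'}

/-- On words in the letters and their adjoints this is equality of distributions. Working with pairs
avoids asking whether `a i ↦ x i` extends to a homomorphism. -/
theorem extend_eq_of_mem_pairAlgebra (ha : ∀ i, a i ∈ ω.domain) (hx : ∀ i, x i ∈ ψ.domain)
    (h : SameDistribution ω (fun i => ⟨a i, ha i⟩) ψ (fun i => ⟨x i, hx i⟩)) {g : R × R'}
    (hg : g ∈ pairAlgebra a x) : ω.extend g.1 = ψ.extend g.2 := by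
  have h1 := forall_mem_adjoin_range_of_list_prod
    (LinearMap.ker (ω.extend ∘ₗ LinearMap.fst ℂ R R' - ψ.extend ∘ₗ LinearMap.snd ℂ R R'))
    (fun l hl => ?_) (mem_adjoin_range_starLetter_of_mem_adjoin hg)
  · simpa [sub_eq_zero] using h1
  · have h2 := (sameDistribution_iff_extend ha hx).1 h l hl
    rw [list_map_prod_eq_mk]
    have e1 : ∀ p : ι × Bool, (starLetter (fun i => (a i, x i)) p).1 = starLetter a p := by
      rintro ⟨i, _ | _⟩ <;> rfl
    have e2 : ∀ p : ι × Bool, (starLetter (fun i => (a i, x i)) p).2 = starLetter x p := by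
      rintro ⟨i, _ | _⟩ <;> rfl
    simp only [e1, e2]
    simpa [sub_eq_zero] using h2

/-- The algebra generated by the pairs `(a b, τ(b) x)`, where `(a, x)` runs through an algebra of
pairs. -/
def cyclicPairAlgebra (τ : R →ₗ[ℂ] ℂ) (G : NonUnitalStarSubalgebra ℂ (R × R'))
    (B : StarSubalgebra ℂ R) : NonUnitalSubalgebra ℂ (R × R') :=
  NonUnitalAlgebra.adjoin ℂ
    (Set.range fun p : G × B => ((p.1 : R × R').1 * (p.2 : R), τ p.2 • (p.1 : R × R').2))

variable {τ : R →ₗ[ℂ] ℂ} {G : NonUnitalStarSubalgebra ℂ (R × R')} {B : StarSubalgebra ℂ R}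
  {A : NonUnitalStarSubalgebra ℂ R}

theorem mem_cyclicPairAlgebra {g : R × R'} (hg : g ∈ G) {b : R} (hb : b ∈ B) :
    (g.1 * b, τ b • g.2) ∈ cyclicPairAlgebra τ G B :=
  NonUnitalAlgebra.subset_adjoin ℂ ⟨(⟨g, hg⟩, ⟨b, hb⟩), rfl⟩

theorem fst_mem_cyclicIdeal_of_mem_cyclicPairAlgebra (hG : ∀ g ∈ G, g.1 ∈ A) {e : R × R'}
    (he : e ∈ cyclicPairAlgebra τ G B) : e.1 ∈ cyclicIdeal A B := by
  induction he using NonUnitalAlgebra.adjoin_induction with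
  | mem y hy =>
    obtain ⟨p, rfl⟩ := hy
    exact mul_mem_cyclicIdeal_right p.2.2 (mem_cyclicIdeal_of_mem (hG _ p.1.2))
  | zero => exact zero_mem _
  | add y z _ _ hy hz => exact add_mem hy hz
  | mul y z _ _ hy hz => exact mul_mem_cyclicIdeal hy hz
  | smul c y _ hy => exact Submodule.smul_mem _ c hy

theorem snd_mem_of_mem_cyclicPairAlgebra {D : NonUnitalStarSubalgebra ℂ R'}
    (hG : ∀ g ∈ G, g.2 ∈ D) {e : R × R'} (he : e ∈ cyclicPairAlgebra τ G B) : e.2 ∈ D := by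
  induction he using NonUnitalAlgebra.adjoin_induction with
  | mem y hy =>
    obtain ⟨p, rfl⟩ := hy
    exact SMulMemClass.smul_mem _ (hG _ p.1.2)
  | zero => exact zero_mem _
  | add y z _ _ hy hz => exact add_mem hy hz
  | mul y z _ _ hy hz => exact mul_mem hy hz
  | smul c y _ hy => exact SMulMemClass.smul_mem c hy

theorem list_map_smul_prod {κ : Type*} (c : κ → ℂ) (f : κ → R) (l : List κ) :
    (l.map fun i => c i • f i).prod = (l.map c).prod • (l.map f).prod := by
  induction l with
  | nil => simp
  | cons i l ih =>
    rw [List.map_cons, List.map_cons, List.map_cons, List.prod_cons, List.prod_cons, List.prod_cons,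
      ih, smul_mul_smul_comm]

/-- On a word of generators, cyclic monotonicity splits off the scalars `τ b`, which are already
present in the second component; what remains is a product in `G`. -/
theorem extend_eq_of_mem_cyclicPairAlgebra (h : IsCyclicallyMonotone ω τ A B)
    (hG : ∀ g ∈ G, g.1 ∈ A) (hG' : ∀ g ∈ G, ω.extend g.1 = ψ.extend g.2) {e : R × R'}
    (he : e ∈ cyclicPairAlgebra τ G B) : ω.extend e.1 = ψ.extend e.2 := by
  have h1 := forall_mem_adjoin_range_of_list_prod
    (LinearMap.ker (ω.extend ∘ₗ LinearMap.fst ℂ R R' - ψ.extend ∘ₗ LinearMap.snd ℂ R R'))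
    (fun l hl => ?_) he
  · simpa [sub_eq_zero] using h1
  · rw [list_map_prod_eq_mk, list_map_smul_prod]
    have h2 := h.extend_list_prod
      (l := l.map fun p : G × B => ((⟨_, hG _ p.1.2⟩ : A), p.2)) (by simpa using hl)
    rw [List.map_map, List.map_map, List.map_map] at h2
    have h3 := hG' _ (list_prod_mem_of_ne_nil G (l := l.map fun p : G × B => (p.1 : R × R'))
      (by simpa using hl) (by
        intro y hy
        obtain ⟨p, -, rfl⟩ := List.mem_map.1 hy
        exact p.1.2))
    rw [list_map_prod_eq_mk] at h3
    simp only [Function.comp_def] at h2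
    rw [LinearMap.mem_ker, LinearMap.sub_apply, sub_eq_zero]
    simp only [LinearMap.comp_apply, LinearMap.fst_apply, LinearMap.snd_apply, map_smul]
    rw [h2, h3, smul_eq_mul, mul_comm]

end PairAlgebras

/-! ### Traces of matrix words and the operator model of `Y` -/

section MatrixTraces

open scoped ComplexOrder

theorem matrix_mul_apply_mem {R S n : Type*} [Ring R] [SetLike S R] [AddSubmonoidClass S R]
    [Fintype n] (V : S) {M N : Matrix n n R} (h : ∀ i l j, M i l * N l j ∈ V) (i j : n) :
    (M * N) i j ∈ V := by
  rw [Matrix.mul_apply]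
  exact sum_mem fun l _ => h i l j

theorem matrix_one_apply_mem {R S n : Type*} [Ring R] [SetLike S R] [SubringClass S R]
    [DecidableEq n] (V : S) (i j : n) : (1 : Matrix n n R) i j ∈ V := by
  rw [Matrix.one_apply]
  split_ifs
  · exact one_mem V
  · exact zero_mem V

variable {R R' : Type*} [Ring R] [StarRing R] [Algebra ℂ R] [StarModule ℂ R]
  [Ring R'] [StarRing R'] [Algebra ℂ R'] [StarModule ℂ R'] {n : Type*} [Fintype n] [DecidableEq n]
  {ω : TracialWeight R} {ψ : TracialWeight R'} {τ : R →ₗ[ℂ] ℂ}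
  {A : NonUnitalStarSubalgebra ℂ R} {B : StarSubalgebra ℂ R}
  {G : NonUnitalStarSubalgebra ℂ (R × R')}

theorem matrix_extend_eq_of_pairedEntries {E : NonUnitalSubalgebra ℂ (R × R')}
    (h₁ : ∀ e ∈ E, e.1 ∈ ω.domain) (h₂ : ∀ e ∈ E, e.2 ∈ ψ.domain)
    (h : ∀ e ∈ E, ω.extend e.1 = ψ.extend e.2) {M : Matrix n n R} {M' : Matrix n n R'}
    (hM : PairedEntries E M M') : (ω.matrix n).extend M = (ψ.matrix n).extend M' := by
  rw [ω.matrix_extend fun i j => h₁ _ (hM i j), ψ.matrix_extend fun i j => h₂ _ (hM i j)]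
  exact Finset.sum_congr rfl fun i _ => h _ (hM i i)

/-- The factor `L` may lie outside the domain, but `L S` and `T L` do not, so traciality applies
twice: `L S · T`, then `T · L S = T L · S`, then `S · T L`. -/
theorem matrix_extend_mul_mul_comm (hI : ∀ x ∈ cyclicIdeal A B, x ∈ ω.domain)
    {L S T : Matrix n n R} (hL : ∀ i j, L i j ∈ B) (hS : ∀ i j, S i j ∈ cyclicIdeal A B)
    (hT : ∀ i j, T i j ∈ cyclicIdeal A B) :
    (ω.matrix n).extend (L * (S * T)) = (ω.matrix n).extend (S * T * L) := by
  have hLS : L * S ∈ (ω.matrix n).domain := fun i j => hI _ (matrix_mul_apply_mem _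
    (fun i l j => mul_mem_cyclicIdeal_left (hL i l) (hS l j)) i j)
  have hTL : T * L ∈ (ω.matrix n).domain := fun i j => hI _ (matrix_mul_apply_mem _
    (fun i l j => mul_mem_cyclicIdeal_right (hL l j) (hT i l)) i j)
  have hS' : S ∈ (ω.matrix n).domain := fun i j => hI _ (hS i j)
  have hT' : T ∈ (ω.matrix n).domain := fun i j => hI _ (hT i j)
  rw [← mul_assoc, (ω.matrix n).extend_mul_comm hLS hT', ← mul_assoc,
    (ω.matrix n).extend_mul_comm hTL hS', mul_assoc]

theorem matrix_extend_mul_comm_of_forall (hI : ∀ x ∈ cyclicIdeal A B, x ∈ ω.domain)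
    (h : ∀ b ∈ B, ∀ x ∈ cyclicIdeal A B, ω.extend (b * x) = ω.extend (x * b))
    {L M : Matrix n n R} (hL : ∀ i j, L i j ∈ B) (hM : ∀ i j, M i j ∈ cyclicIdeal A B) :
    (ω.matrix n).extend (L * M) = (ω.matrix n).extend (M * L) := by
  rw [ω.matrix_extend fun i j => hI _ (matrix_mul_apply_mem _
      (fun i l j => mul_mem_cyclicIdeal_left (hL i l) (hM l j)) i j),
    ω.matrix_extend fun i j => hI _ (matrix_mul_apply_mem _
      (fun i l j => mul_mem_cyclicIdeal_right (hL l j) (hM i l)) i j)]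
  simp only [Matrix.mul_apply, map_sum]
  rw [Finset.sum_comm]
  exact Finset.sum_congr rfl fun i _ => Finset.sum_congr rfl fun j _ => h _ (hL j i) _ (hM i j)

theorem mul_pow_mul_eq_pow_succ {M : Type*} [Monoid M] (u b : M) (m : ℕ) :
    u * (b * u) ^ m * b = (u * b) ^ (m + 1) := by
  induction m with
  | zero => simp
  | succ m ih => rw [pow_succ' (u * b), ← ih, pow_succ']; simp only [mul_assoc]

/-- The power is `L` times the product of `U` and `(L U) ^ (m - 1)`. The bound `2 ≤ m` puts the last
factor over the ideal. -/
theorem matrix_extend_mul_pow (hI : ∀ x ∈ cyclicIdeal A B, x ∈ ω.domain)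
    {L U : Matrix n n R} (hL : ∀ i j, L i j ∈ B) (hU : ∀ i j, U i j ∈ cyclicIdeal A B)
    {m : ℕ} (hm : 2 ≤ m) : (ω.matrix n).extend ((L * U) ^ m) = (ω.matrix n).extend ((U * L) ^ m) := by
  obtain ⟨m, rfl⟩ := Nat.exists_eq_add_of_le' hm
  have hLU : ∀ i j, (L * U) i j ∈ cyclicIdeal A B := matrix_mul_apply_mem _
    fun i l j => mul_mem_cyclicIdeal_left (hL i l) (hU l j)
  have hpow : ∀ m : ℕ, ∀ i j, ((L * U) ^ (m + 1)) i j ∈ cyclicIdeal A B := by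
    intro m
    induction m with
    | zero => simpa using hLU
    | succ m ih =>
      rw [pow_succ]
      exact matrix_mul_apply_mem _ fun i l j => mul_mem_cyclicIdeal (ih i l) (hLU l j)
  rw [← mul_pow_mul_eq_pow_succ U L (m + 1), ← matrix_extend_mul_mul_comm hI hL hU (hpow m),
    pow_succ', mul_assoc]

theorem PairedEntries.mul_expectation {M : Matrix n n R} {M' : Matrix n n R'}
    (hM : PairedEntries G M M') {N : Matrix n n R} (hN : ∀ i j, N i j ∈ B) :
    PairedEntries (cyclicPairAlgebra τ G B) (M * N)
      (M' * (N.map τ).map (algebraMap ℂ R')) := by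
  intro i j
  have h : ((M * N) i j, (M' * (N.map τ).map (algebraMap ℂ R')) i j) =
      ∑ l, (M i l * N l j, τ (N l j) • M' i l) := by
    rw [Prod.ext_iff, Prod.fst_sum, Prod.snd_sum]
    constructor
    · simp [Matrix.mul_apply]
    · simp [Matrix.mul_apply, Algebra.smul_def, Algebra.commutes]
  rw [h]
  exact sum_mem fun l _ => mem_cyclicPairAlgebra (hM i l) (hN l j)

theorem map_algebraMap_mul {l m o : Type*} [Fintype m] (c : Matrix l m ℂ) (d : Matrix m o ℂ) :
    (c * d).map (algebraMap ℂ R') = c.map (algebraMap ℂ R') * d.map (algebraMap ℂ R') :=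
  Matrix.map_mul

theorem conjTranspose_map_algebraMap {l m : Type*} (c : Matrix l m ℂ) :
    (c.map (algebraMap ℂ R')).conjTranspose = c.conjTranspose.map (algebraMap ℂ R') := by
  ext i j
  exact (algebraMap_star_comm _).symm

theorem sum_map_algebraMap_mul_comm {m : Type*} [Fintype m] (φ : R' →ₗ[ℂ] ℂ) (c : Matrix m n ℂ)
    (M : Matrix n m R') :
    ∑ i, φ ((c.map (algebraMap ℂ R') * M) i i) = ∑ i, φ ((M * c.map (algebraMap ℂ R')) i i) := by
  simp only [Matrix.mul_apply, map_sum, Matrix.map_apply, Algebra.commutes]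
  rw [Finset.sum_comm]

/-- Multiplication by matrices `N` over `B` on the right turns `P` and `p` into matrices with paired
entries, if `N` is replaced by its expectation for the second matrix. -/
def IsExpectationPair (τ : R →ₗ[ℂ] ℂ) (G : NonUnitalStarSubalgebra ℂ (R × R'))
    (B : StarSubalgebra ℂ R) (P : Matrix n n R) (p : Matrix n n R') : Prop :=
  ∀ N : Matrix n n R, (∀ i j, N i j ∈ B) →
    PairedEntries (cyclicPairAlgebra τ G B) (P * N) (p * (N.map τ).map (algebraMap ℂ R'))

theorem IsExpectationPair.mul {P Q : Matrix n n R} {p q : Matrix n n R'}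
    (hP : IsExpectationPair τ G B P p) (hQ : IsExpectationPair τ G B Q q) {C : Matrix n n R}
    (hC : ∀ i j, C i j ∈ B) :
    IsExpectationPair τ G B (P * C * Q) (p * (C.map τ).map (algebraMap ℂ R') * q) := by
  intro N hN
  rw [mul_assoc, mul_assoc _ q]
  exact (hP C hC).mul (hQ N hN)

theorem IsExpectationPair.apply_mem (hG : ∀ g ∈ G, g.1 ∈ A) {P : Matrix n n R} {p : Matrix n n R'}
    (hP : IsExpectationPair τ G B P p) (i j : n) : P i j ∈ cyclicIdeal A B := by
  have h := fst_mem_cyclicIdeal_of_mem_cyclicPairAlgebra hG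
    (hP 1 (matrix_one_apply_mem B) i j)
  simpa using h

/-- Adjoints are carried along because `cyclicPairAlgebra` has its `B` factors on the right and is
only a subalgebra, not assumed closed under `star`. -/
theorem IsExpectationPair.list_prod_mul (hτ : ∀ b ∈ B, τ (star b) = star (τ b)) {κ : Type*}
    {P C : κ → Matrix n n R} {p : κ → Matrix n n R'} (hC : ∀ k i j, C k i j ∈ B)
    (hP : ∀ k, IsExpectationPair τ G B (P k) (p k) ∧
      IsExpectationPair τ G B (star (P k)) (star (p k)))
    {Q : Matrix n n R} {q : Matrix n n R'}
    (hQ : IsExpectationPair τ G B Q q ∧ IsExpectationPair τ G B (star Q) (star q)) (l : List κ) :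
    IsExpectationPair τ G B ((l.map fun k => P k * C k).prod * Q)
        ((l.map fun k => p k * ((C k).map τ).map (algebraMap ℂ R')).prod * q) ∧
      IsExpectationPair τ G B (star ((l.map fun k => P k * C k).prod * Q))
        (star ((l.map fun k => p k * ((C k).map τ).map (algebraMap ℂ R')).prod * q)) := by
  induction l with
  | nil => simpa using hQ
  | cons k l ih =>
    have hstar : star (((C k).map τ).map (algebraMap ℂ R')) =
        ((star (C k)).map τ).map (algebraMap ℂ R') := by
      ext i j
      rw [Matrix.star_apply, Matrix.map_apply, Matrix.map_apply, Matrix.map_apply, Matrix.map_apply,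
        Matrix.star_apply, hτ _ (hC k j i), algebraMap_star_comm]
    have hCs : ∀ i j, star (C k) i j ∈ B := fun i j => star_mem (hC k j i)
    rw [List.map_cons, List.map_cons, List.prod_cons, List.prod_cons,
      mul_assoc (P k * C k), mul_assoc (p k * _)]
    refine ⟨(hP k).1.mul ih.1 (hC k), ?_⟩
    rw [star_mul, star_mul (P k), star_mul (p k * _), star_mul (p k), hstar, ← mul_assoc,
      ← mul_assoc]
    exact ih.2.mul (hP k).2 hCs

/-- Matrices of expectations of products over a `*`-algebra with a positive functional are Gram
matrices. -/
theorem exists_gram_expectation (hτ : ∀ b ∈ B, τ (star b) = star (τ b))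
    (hpos : ∀ b ∈ B, 0 ≤ τ (star b * b)) {κ : Type*} [Fintype κ] [DecidableEq κ]
    {W : κ → Matrix n n R} (hW : ∀ k i j, W k i j ∈ B) :
    ∃ (m : ℕ) (X : κ → Matrix (Fin m) n ℂ), ∀ k l,
      (star (W k) * W l).map τ = (X k).conjTranspose * X l := by
  -- The block matrix with blocks the expectations of `W_k* W_l`. Its quadratic form is a sum of
  -- values `τ(v* v)` with `v` a linear combination of entries of the `W_k`.
  set Γ : Matrix (κ × n) (κ × n) ℂ :=
    Matrix.of fun s t => τ ((star (W s.1) * W t.1) s.2 t.2) with hΓ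
  have hΓapp : ∀ s t, Γ s t = ∑ i, τ (star (W s.1 i s.2) * W t.1 i t.2) := fun s t => by
    simp [hΓ, Matrix.mul_apply]
  have hherm : Γ.IsHermitian := by
    ext s t
    rw [Matrix.conjTranspose_apply, hΓapp, hΓapp, star_sum]
    refine Finset.sum_congr rfl fun i _ => ?_
    rw [← hτ _ (mul_mem (star_mem (hW _ _ _)) (hW _ _ _))]
    simp
  have hsemi : Γ.PosSemidef := by
    refine .of_dotProduct_mulVec_nonneg hherm fun c => ?_
    have h : star c ⬝ᵥ (Γ.mulVec c) =
        ∑ i, τ (star (∑ s, c s • W s.1 i s.2) * ∑ s, c s • W s.1 i s.2) := by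
      simp only [dotProduct, Matrix.mulVec, hΓapp, star_sum, Finset.sum_mul, Finset.mul_sum,
        map_sum, star_smul, smul_mul_smul_comm, map_smul, smul_eq_mul, Pi.star_apply]
      rw [Finset.sum_comm]
      conv_rhs => rw [Finset.sum_comm]
      refine Finset.sum_congr rfl fun s _ => ?_
      conv_rhs => rw [Finset.sum_comm]
      refine Finset.sum_congr rfl fun t _ => Finset.sum_congr rfl fun i _ => ?_
      ring
    rw [h]
    exact Finset.sum_nonneg fun i _ =>
      hpos _ (sum_mem fun s _ => SMulMemClass.smul_mem _ (hW _ _ _))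
  obtain ⟨m, v, hv⟩ := Matrix.posSemidef_iff_eq_sum_vecMulVec.1 hsemi
  -- The row `r` of each `X k` is the conjugate of the `k`-part of the rank one term `v r` of `Γ`,
  -- so `m` is the number of these terms.
  refine ⟨m, fun k => Matrix.of fun r i => star (v r (k, i)), fun k l => ?_⟩
  ext i j
  have h : Γ (k, i) (l, j) = ∑ r, v r (k, i) * star (v r (l, j)) := by
    rw [hv, Matrix.sum_apply]
    rfl
  rw [Matrix.mul_apply]
  refine h.trans (Finset.sum_congr rfl fun r _ => ?_)
  simp

/-- The `*`-moments of `L P R` are those of a matrix over the second algebra, if `P` corresponds to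
a matrix `p` over it. -/
theorem exists_matrix_moments_eq (hI : IsCyclicallyMonotone ω τ A B)
    (hG : ∀ g ∈ G, g.1 ∈ A) (hG' : ∀ g ∈ G, g.2 ∈ ψ.domain)
    (hGe : ∀ g ∈ G, ω.extend g.1 = ψ.extend g.2)
    (hτ : ∀ b ∈ B, τ (star b) = star (τ b)) (hpos : ∀ b ∈ B, 0 ≤ τ (star b * b))
    {L P N : Matrix n n R} {p : Matrix n n R'} (hL : ∀ i j, L i j ∈ B) (hN : ∀ i j, N i j ∈ B)
    (hp : ∀ i j, p i j ∈ ψ.domain)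
    (hP : IsExpectationPair τ G B P p ∧ IsExpectationPair τ G B (star P) (star p))
    (hcomm : ∀ S T : Matrix n n R, (∀ i j, S i j ∈ B) → (∀ i j, T i j ∈ B) →
      (ω.matrix n).extend (S * (P * T)) = (ω.matrix n).extend (P * T * S) ∧
      (ω.matrix n).extend (S * (star P * T)) = (ω.matrix n).extend (star P * T * S)) :
    ∃ (m : ℕ) (y : Matrix (Fin m) (Fin m) R'), (∀ i j, y i j ∈ ψ.domain) ∧
      ∀ l : List (Unit × Bool), l ≠ [] →
        (ω.matrix n).extend ((l.map (starLetter fun _ => L * P * N)).prod) =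
          (ψ.matrix (Fin m)).extend ((l.map (starLetter fun _ => y)).prod) := by
  -- With `W_false = L` and `W_true = N*`, the letter `ε` is `W_ε P^ε W_{!ε}*`, for the matrix and
  -- for its adjoint alike.
  set W : Bool → Matrix n n R := fun ε => if ε then star N else L with hWdef
  have hW : ∀ ε i j, W ε i j ∈ B := by
    rintro (_ | _) i j
    · exact hL i j
    · exact star_mem (hN j i)
  have hW' : ∀ ε i j, star (W ε) i j ∈ B := fun ε i j => star_mem (hW ε j i)
  have hWW : ∀ ε δ i j, (star (W ε) * W δ) i j ∈ B := fun ε δ => matrix_mul_apply_mem _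
    fun i l j => mul_mem (hW' ε i l) (hW δ l j)
  obtain ⟨m, X, hX⟩ := exists_gram_expectation hτ hpos hW
  -- The model replaces `L` and `N*` by scalar matrices with the same mutual products in
  -- expectation.
  set y : Matrix (Fin m) (Fin m) R' := (X false).map (algebraMap ℂ R') * p *
    (X true).conjTranspose.map (algebraMap ℂ R') with hy
  have hydom : ∀ i j, y i j ∈ ψ.domain := by
    intro i j
    rw [hy, Matrix.mul_apply]
    refine sum_mem fun l _ => ?_
    rw [Matrix.map_apply, ← Algebra.commutes, ← Algebra.smul_def, Matrix.mul_apply]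
    refine SMulMemClass.smul_mem _ (sum_mem fun k _ => ?_)
    rw [Matrix.map_apply, ← Algebra.smul_def]
    exact SMulMemClass.smul_mem _ (hp k l)
  set Pl : Bool → Matrix n n R := fun ε => if ε then star P else P with hPl
  set pl : Bool → Matrix n n R' := fun ε => if ε then star p else p with hpl
  have hPlpl : ∀ ε, IsExpectationPair τ G B (Pl ε) (pl ε) := by
    rintro (_ | _)
    · exact hP.1
    · exact hP.2
  have hY : ∀ ε, starLetter (fun _ : Unit => L * P * N) ((), ε) = W ε * Pl ε * star (W !ε) := by
    rintro (_ | _)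
    · simp [starLetter, hWdef, hPl]
    · simp [starLetter, hWdef, hPl, mul_assoc]
  have hyl : ∀ ε, starLetter (fun _ : Unit => y) ((), ε) = (X ε).map (algebraMap ℂ R') * pl ε *
      (X !ε).conjTranspose.map (algebraMap ℂ R') := by
    rintro (_ | _)
    · simp [starLetter, hpl, hy]
    · simp only [starLetter, hpl, hy, if_true, Matrix.star_eq_conjTranspose,
        Matrix.conjTranspose_mul, conjTranspose_map_algebraMap, Matrix.conjTranspose_conjTranspose,
        Bool.not_true, Matrix.mul_assoc]
  -- Every word has the shape `W_ε Q W_δ*`: the inner products `W* W` are absorbed in `Q`, and only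
  -- the two outer factors remain to be joined cyclically.
  have key : ∀ l : List (Unit × Bool), l ≠ [] → ∃ (Q : Matrix n n R) (q : Matrix n n R')
      (ε δ : Bool), (l.map (starLetter fun _ => L * P * N)).prod = W ε * Q * star (W δ) ∧
      (l.map (starLetter fun _ => y)).prod = (X ε).map (algebraMap ℂ R') * q *
        (X δ).conjTranspose.map (algebraMap ℂ R') ∧
      IsExpectationPair τ G B Q q ∧
      ∀ S T : Matrix n n R, (∀ i j, S i j ∈ B) → (∀ i j, T i j ∈ B) →
        (ω.matrix n).extend (S * (Q * T)) = (ω.matrix n).extend (Q * T * S) := by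
    intro l hl
    induction l with
    | nil => exact absurd rfl hl
    | cons u l ih =>
      obtain ⟨⟨⟩, ε⟩ := u
      rcases eq_or_ne l [] with rfl | hl'
      · refine ⟨Pl ε, pl ε, ε, !ε, by simp [hY], by simp [hyl], hPlpl ε, fun S T hS hT => ?_⟩
        rcases ε with _ | _
        · exact (hcomm S T hS hT).1
        · exact (hcomm S T hS hT).2
      · obtain ⟨Q, q, δ, γ, h1, h2, h3, -⟩ := ih hl'
        have h4 := (hPlpl ε).mul h3 (hWW (!ε) δ)
        refine ⟨_, _, ε, γ, ?_, ?_, h4, fun S T hS hT => ?_⟩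
        · rw [List.map_cons, List.prod_cons, h1, hY]
          simp only [Matrix.mul_assoc]
        · rw [List.map_cons, List.prod_cons, h2, hyl, hX, map_algebraMap_mul]
          simp only [Matrix.mul_assoc]
        -- For words of length at least two, `Q` has two factors over the ideal, so cyclicity is
        -- automatic; `hcomm` is needed only for single letters.
        · rw [mul_assoc _ Q T]
          refine matrix_extend_mul_mul_comm hI.1 hS
            (matrix_mul_apply_mem _ fun i l j => ?_) (matrix_mul_apply_mem _ fun i l j => ?_)
          · exact mul_mem_cyclicIdeal_right (hWW _ _ _ _) ((hPlpl ε).apply_mem hG i l)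
          · exact mul_mem_cyclicIdeal_right (hT l j) (h3.apply_mem hG i l)
  refine ⟨m, y, hydom, fun l hl => ?_⟩
  have hdom : (l.map (starLetter fun _ => y)).prod ∈ (ψ.matrix (Fin m)).domain := by
    refine list_prod_mem_of_ne_nil _ (by simpa using hl) fun z hz => ?_
    obtain ⟨⟨_, _ | _⟩, -, rfl⟩ := List.mem_map.1 hz
    · exact hydom
    · exact star_mem (s := (ψ.matrix (Fin m)).domain) hydom
  obtain ⟨Q, q, ε, δ, h1, h2, h3, h4⟩ := key l hl
  have h5 := h3 _ (hWW δ ε)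
  rw [ψ.matrix_extend hdom, h1, h2, Matrix.mul_assoc, h4 _ _ (hW ε) (hW' δ), Matrix.mul_assoc,
    matrix_extend_eq_of_pairedEntries (ψ := ψ)
      (fun e he => hI.1 _ (fst_mem_cyclicIdeal_of_mem_cyclicPairAlgebra hG he))
      (fun e he => snd_mem_of_mem_cyclicPairAlgebra hG' he)
      (fun e he => extend_eq_of_mem_cyclicPairAlgebra hI hG hGe he) h5,
    ψ.matrix_extend fun i j => snd_mem_of_mem_cyclicPairAlgebra hG' (h5 i j),
    Matrix.mul_assoc ((X ε).map _), sum_map_algebraMap_mul_comm, hX, map_algebraMap_mul,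
    Matrix.mul_assoc]

end MatrixTraces

/-! ### Faithfulness of the trace and eigenvalues from moments -/

section Eigenvalues

open scoped InnerProductSpace

/-- The trace is the sum of `‖T e‖ ^ 2` over a Hilbert basis, so `T` kills every basis vector. -/
theorem eq_zero_of_operatorTrace_star_mul_self_eq_zero {H : Type*} [NormedAddCommGroup H]
    [InnerProductSpace ℂ H] [CompleteSpace H] {T : H →L[ℂ] H} (hT : IsTraceClassOperator T)
    (h : operatorTrace (star T * T) = 0) : T = 0 := by
  obtain ⟨w, e, -⟩ := exists_hilbertBasis ℂ H
  have h1 := hasSum_operatorTrace e (isTraceClassOperator_mul (star T) hT)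
  have h2 : ∀ i, ⟪e i, (star T * T) (e i)⟫_ℂ = ((‖T (e i)‖ ^ 2 : ℝ) : ℂ) := fun i => by
    rw [ContinuousLinearMap.star_eq_adjoint]
    refine (ContinuousLinearMap.adjoint_inner_right T _ _).trans ?_
    change ⟪T (e i), T (e i)⟫_ℂ = _
    rw [inner_self_eq_norm_sq_to_K]
    norm_cast
  simp only [h2, h] at h1
  have h3 : HasSum (fun i => ‖T (e i)‖ ^ 2) 0 := Complex.hasSum_ofReal.1 (by simpa using h1)
  have h4 := (hasSum_zero_iff_of_nonneg fun i => sq_nonneg ‖T (e i)‖).1 h3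
  have h5 : ∀ i, T (e i) = 0 := fun i => by simpa using congrFun h4 i
  ext x
  have h6 := (e.hasSum_repr x).mapL T
  simp only [map_smul, h5, smul_zero] at h6
  exact h6.unique hasSum_zero

theorem hilbertTrace_extend {H : Type*} [NormedAddCommGroup H] [InnerProductSpace ℂ H]
    [CompleteSpace H] {T : H →L[ℂ] H} (hT : IsTraceClassOperator T) :
    (hilbertTrace H).extend T = operatorTrace T :=
  (hilbertTrace H).extend_apply hT

/-- If the moments of order at least two of a trace class element are the traces of the powers of a
trace class operator, then its eigenvalues are those of the operator. -/
theorem hasEV_of_extend_pow_eq {A : Type*} [Ring A] [StarRing A] [Algebra ℂ A]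
    {ω : TracialWeight A} {a : A} {K : Type*} [NormedAddCommGroup K] [InnerProductSpace ℂ K]
    [CompleteSpace K] {T : K →L[ℂ] K} (hT : IsTraceClassOperator T)
    (ha : IsTraceClass ω fun _ : Unit => a)
    (h : ∀ m, 2 ≤ m → ω.extend (a ^ m) = operatorTrace (T ^ m)) :
    HasEV ω a (eigenvalueMultiplicity T) := by
  refine ⟨ha, fun ha H _ _ _ _ x hx => ?_⟩
  refine eigenvalueMultiplicity_eq_of_operatorTrace_pow_eq x.2 hT fun m hm => ?_
  have h1 := (sameDistribution_iff_extend (a := fun _ : Unit => a) (fun _ => ha)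
    (b := fun _ : Unit => (x : H →L[ℂ] H)) (fun _ => x.2)).1 hx
    (List.replicate m ((), false)) (by simp; omega)
  rw [List.map_replicate, List.map_replicate, List.prod_replicate, List.prod_replicate] at h1
  have h2 : IsTraceClassOperator ((x : H →L[ℂ] H) ^ m) := by
    obtain ⟨m, rfl⟩ := Nat.exists_eq_add_of_le' hm
    rw [pow_succ]
    exact isTraceClassOperator_mul _ x.2
  rw [← hilbertTrace_extend h2, ← h m hm]
  exact h1.symm

theorem operatorMatrix_pow {H ι : Type*} [NormedAddCommGroup H] [InnerProductSpace ℂ H]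
    [CompleteSpace H] [Fintype ι] [DecidableEq ι] (M : Matrix ι ι (H →L[ℂ] H)) (m : ℕ) :
    operatorMatrix (M ^ m) = operatorMatrix M ^ m := by
  induction m with
  | zero => rw [pow_zero, pow_zero, operatorMatrix_one]
  | succ m ih => rw [pow_succ, pow_succ, operatorMatrix_mul, ih]

theorem PairedEntries.pow {R R' n : Type*} [Ring R] [Algebra ℂ R] [Ring R'] [Algebra ℂ R']
    [Fintype n] [DecidableEq n] {E : NonUnitalSubalgebra ℂ (R × R')} {M : Matrix n n R}
    {M' : Matrix n n R'} (h : PairedEntries E M M') {m : ℕ} (hm : m ≠ 0) :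
    PairedEntries E (M ^ m) (M' ^ m) := by
  have h1 := PairedEntries.list_prod (f := fun _ : Unit => M) (f' := fun _ : Unit => M')
    (l := List.replicate m ()) (by simpa using hm) (fun _ _ => h)
  simpa using h1

theorem list_prod_mul_mem {M S κ : Type*} [Monoid M] [SetLike S M] [MulMemClass S M] (s : S)
    {f : κ → M} {l : List κ} (h : ∀ k ∈ l, f k ∈ s) {x : M} (hx : x ∈ s) :
    (l.map f).prod * x ∈ s := by
  induction l with
  | nil => simpa using hx
  | cons k l ih =>
    rw [List.map_cons, List.prod_cons, mul_assoc]
    exact mul_mem (h k (by simp)) (ih fun j hj => h j (by simp [hj]))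

theorem TracialWeight.mul_map_algebraMap_mem_matrix_domain {R n : Type*} [Ring R] [StarRing R]
    [Algebra ℂ R] [Fintype n] [DecidableEq n] (ω : TracialWeight R) {M : Matrix n n R}
    (hM : ∀ i j, M i j ∈ ω.domain) (c : Matrix n n ℂ) :
    M * c.map (algebraMap ℂ R) ∈ (ω.matrix n).domain := by
  refine matrix_mul_apply_mem _ fun i l j => ?_
  rw [Matrix.map_apply, ← Algebra.commutes, ← Algebra.smul_def]
  exact SMulMemClass.smul_mem _ (hM i l)

end Eigenvalues

/-! ### The theorem -/

theorem theorem3p3 {𝒜 : Type*} [Ring 𝒜] [StarRing 𝒜] [Algebra ℂ 𝒜] [StarModule ℂ 𝒜]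
    (τ : 𝒜 →ₗ[ℂ] ℂ) (hτ : τ 1 = 1) (ω : TracialWeight 𝒜)
    (n k : ℕ) (hk : 1 ≤ k)
    (A : Fin k → Matrix (Fin n) (Fin n) 𝒜) (B : Fin (k + 1) → Matrix (Fin n) (Fin n) 𝒜)
    (hA : IsTraceClass ω (fun s : Fin k × Fin n × Fin n => A s.1 s.2.1 s.2.2))
    (𝔄 : NonUnitalStarSubalgebra ℂ 𝒜)
    (h𝔄 : 𝔄 = NonUnitalStarAlgebra.adjoin ℂ {x : 𝒜 | ∃ p i j, A p i j = x})
    (𝔅 : StarSubalgebra ℂ 𝒜)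
    (h𝔅 : 𝔅 = StarAlgebra.adjoin ℂ {x : 𝒜 | ∃ q i j, B q i j = x})
    (hAB : IsCyclicallyMonotone ω τ 𝔄 𝔅)
    (Y Z : Matrix (Fin n) (Fin n) 𝒜)
    (hY : Y = B 0 * (List.ofFn fun p : Fin k => A p * B p.succ).prod)
    (hZ : Z = (List.ofFn fun p : Fin k => A p * expectationMatrix τ
      (if p.succ = Fin.last k then B (Fin.last k) * B 0 else B p.succ)).prod) :
    (∃ μ : {z : ℂ // z ≠ 0} → ℕ,
      HasEV (ω.matrix (Fin n)) Z μ ∧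
      (IsTraceClass (ω.matrix (Fin n)) (fun _ : Unit => Y) → HasEV (ω.matrix (Fin n)) Y μ)) ∧
    ((2 ≤ k ∨ ∀ b ∈ 𝔅, ∀ x ∈ cyclicIdeal 𝔄 𝔅, ∀ (h₁ : b * x ∈ ω.domain)
        (h₂ : x * b ∈ ω.domain), ω.toFun ⟨b * x, h₁⟩ = ω.toFun ⟨x * b, h₂⟩) →
      IsTraceClass (ω.matrix (Fin n)) (fun _ : Unit => Y)) := by
  obtain ⟨k, rfl⟩ := Nat.exists_eq_add_of_le' hk
  obtain ⟨ha, H, _, _, _, _, x₀, hx₀⟩ := hA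
  set a : Fin (k + 1) × Fin n × Fin n → 𝒜 := fun s => A s.1 s.2.1 s.2.2 with ha_def
  obtain ⟨x, hxdom, hx⟩ : ∃ (x : Fin (k + 1) × Fin n × Fin n → H →L[ℂ] H)
      (h : ∀ s, x s ∈ (hilbertTrace H).domain),
      SameDistribution ω (fun s => ⟨a s, ha s⟩) (hilbertTrace H) (fun s => ⟨x s, h s⟩) :=
    ⟨fun s => x₀ s, fun s => (x₀ s).2, hx₀⟩
  set G := pairAlgebra a x with hGdef
  set X : Fin (k + 1) → Matrix (Fin n) (Fin n) (H →L[ℂ] H) :=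
    fun p => Matrix.of fun i j => x (p, i, j) with hX
  have hrange : 𝔄 = NonUnitalStarAlgebra.adjoin ℂ (Set.range a) := by
    rw [h𝔄]
    congr 1
    ext y
    simp [ha_def]
  have hG₁ : ∀ g ∈ G, g.1 ∈ 𝔄 := fun g hg => hrange ▸ fst_mem_of_mem_pairAlgebra hg
  have hG₂ : ∀ g ∈ G, g.2 ∈ (hilbertTrace H).domain := fun g hg => snd_mem_of_mem_pairAlgebra hxdom hg
  have hGe : ∀ g ∈ G, ω.extend g.1 = (hilbertTrace H).extend g.2 := fun g hg =>
    extend_eq_of_mem_pairAlgebra ha hxdom hx hg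
  have hI : ∀ y ∈ cyclicIdeal 𝔄 𝔅, y ∈ ω.domain := hAB.1
  have hGdom : ∀ g ∈ G, g.1 ∈ ω.domain := fun g hg =>
    hI _ (mem_cyclicIdeal_of_mem (hG₁ g hg))
  have hAX : ∀ p, PairedEntries G (A p) (X p) := fun p i j => mem_pairAlgebra (p, i, j)
  have hA𝔄 : ∀ p i j, A p i j ∈ 𝔄 := fun p i j => hG₁ _ (hAX p i j)
  have hB𝔅 : ∀ q i j, B q i j ∈ 𝔅 := fun q i j => by
    rw [h𝔅]
    exact StarAlgebra.subset_adjoin ℂ _ ⟨q, i, j, rfl⟩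
  -- The factor following `A p` once `B 0` has been moved cyclically to the end, where it merges
  -- with the last `B`.
  set D : Fin (k + 1) → Matrix (Fin n) (Fin n) 𝒜 := fun p =>
    if p.succ = Fin.last (k + 1) then B (Fin.last (k + 1)) * B 0 else B p.succ with hD
  have hD𝔅 : ∀ p i j, D p i j ∈ 𝔅 := by
    intro p
    simp only [hD]
    split_ifs
    · exact matrix_mul_apply_mem _ fun i l j => mul_mem (hB𝔅 _ i l) (hB𝔅 _ l j)
    · exact hB𝔅 _
  set S := ((List.finRange k).map fun p => A p.castSucc * B p.castSucc.succ).prod with hS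
  set P := S * A (Fin.last k) with hP
  have hAI : ∀ p i j, A p i j ∈ cyclicIdeal 𝔄 𝔅 := fun p i j =>
    mem_cyclicIdeal_of_mem (hA𝔄 p i j)
  have hYP : Y = B 0 * P * B (Fin.last (k + 1)) := by
    rw [hY, List.ofFn_succ', List.concat_eq_append, List.prod_append, List.prod_singleton,
      List.ofFn_eq_map, Fin.succ_last, hP, hS, mul_assoc, mul_assoc]
  set U := P * B (Fin.last (k + 1)) with hU
  have hYU : Y = B 0 * U := by rw [hYP, hU, mul_assoc]
  have hUD : U * B 0 = ((List.finRange (k + 1)).map fun p => A p * D p).prod := by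
    rw [← List.ofFn_eq_map, List.ofFn_succ', List.concat_eq_append, List.prod_append,
      List.prod_singleton, List.ofFn_eq_map, hU, hP, hS, mul_assoc, mul_assoc]
    congr 2
    · refine List.map_congr_left fun p _ => ?_
      have : p.castSucc.succ ≠ Fin.last (k + 1) := by
        rw [← Fin.succ_last, Ne, Fin.succ_inj]
        exact (Fin.castSucc_lt_last p).ne
      simp only [hD, if_neg this]
    · simp [hD]
  have hEfst : ∀ (σ : 𝒜 →ₗ[ℂ] ℂ), ∀ e ∈ cyclicPairAlgebra σ G 𝔅, e.1 ∈ cyclicIdeal 𝔄 𝔅 :=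
    fun σ e he => fst_mem_cyclicIdeal_of_mem_cyclicPairAlgebra hG₁ he
  have hSI : 1 ≤ k → ∀ i j, S i j ∈ cyclicIdeal 𝔄 𝔅 := fun hk' i j =>
    hEfst τ _ (PairedEntries.list_prod (by simpa using Nat.one_le_iff_ne_zero.1 hk')
      (fun p _ => (hAX p.castSucc).mul_expectation (hB𝔅 p.castSucc.succ)) i j)
  set Zx := ((List.finRange (k + 1)).map fun p =>
    X p * ((D p).map τ).map (algebraMap ℂ (H →L[ℂ] H))).prod with hZx
  have hne : List.finRange (k + 1) ≠ [] := by simp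
  have hZG : PairedEntries G.toNonUnitalSubalgebra Z Zx := by
    rw [hZ, List.ofFn_eq_map]
    exact PairedEntries.list_prod hne fun p _ => PairedEntries.mul_map_algebraMap (hAX p) _
  -- The same `Zx` is paired with `Z` over `G`. This is why `U * B 0` and `Z` have equal moments.
  have hUE : PairedEntries (cyclicPairAlgebra τ G 𝔅) (U * B 0) Zx := by
    rw [hUD]
    exact PairedEntries.list_prod hne fun p _ => (hAX p).mul_expectation (hD𝔅 p)
  have hZxdom : ∀ i j, Zx i j ∈ (hilbertTrace H).domain := fun i j => hG₂ _ (hZG i j)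
  have hZdom : ∀ i j, Z i j ∈ ω.domain := fun i j => hGdom _ (hZG i j)
  have hZG' : ∀ l : List (Unit × Bool), l ≠ [] →
      (ω.matrix (Fin n)).extend ((l.map (starLetter fun _ => Z)).prod) =
        ((hilbertTrace H).matrix (Fin n)).extend ((l.map (starLetter fun _ => Zx)).prod) := by
    intro l hl
    refine matrix_extend_eq_of_pairedEntries (E := G.toNonUnitalSubalgebra) hGdom hG₂ hGe
      (PairedEntries.list_prod hl ?_)
    rintro ⟨_, _ | _⟩ -
    · exact hZG
    · exact PairedEntries.star (G := G) hZG
  have hZclass : IsTraceClass (ω.matrix (Fin n)) (fun _ : Unit => Z) :=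
    ⟨fun _ => hZdom, PiLp 2 (fun _ : Fin n => H), inferInstance, inferInstance, inferInstance,
      inferInstance, fun _ => ⟨operatorMatrix Zx, operatorMatrix_mem_domain hZxdom⟩,
      sameDistribution_operatorMatrix (ω := ω.matrix (Fin n)) (a := fun _ : Unit => Z)
        (fun _ => hZdom)
        (M := fun _ : Unit => Zx) (fun _ => hZxdom) hZG'⟩
  have hZxpow : ∀ m, 2 ≤ m → ((hilbertTrace H).matrix (Fin n)).extend (Zx ^ m) =
      operatorTrace (operatorMatrix Zx ^ m) := by
    intro m hm
    have h1 : ∀ i j, (Zx ^ m) i j ∈ (hilbertTrace H).domain := fun i j =>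
      hG₂ _ (hZG.pow (by omega : m ≠ 0) i j)
    rw [← hilbertTrace_extend_operatorMatrix h1,
      hilbertTrace_extend (operatorMatrix_mem_domain h1), operatorMatrix_pow]
  have hUI : ∀ i j, U i j ∈ cyclicIdeal 𝔄 𝔅 := by
    have h1 : U = ((List.finRange (k + 1)).map fun p => A p * B p.succ).prod := by
      rw [← List.ofFn_eq_map, List.ofFn_succ', List.concat_eq_append, List.prod_append,
        List.prod_singleton, List.ofFn_eq_map, Fin.succ_last, hU, hP, hS, mul_assoc]
    rw [h1]
    exact fun i j => hEfst τ _ (PairedEntries.list_prod hne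
      (fun p _ => (hAX p).mul_expectation (hB𝔅 p.succ)) i j)
  refine ⟨⟨eigenvalueMultiplicity (operatorMatrix Zx), ?_, fun hYclass => ?_⟩, fun hcase => ?_⟩
  · refine hasEV_of_extend_pow_eq (operatorMatrix_mem_domain hZxdom) hZclass fun m hm => ?_
    rw [← hZxpow m hm]
    exact matrix_extend_eq_of_pairedEntries hGdom hG₂ hGe (hZG.pow (by omega))
  · refine hasEV_of_extend_pow_eq (operatorMatrix_mem_domain hZxdom) hYclass fun m hm => ?_
    rw [← hZxpow m hm, hYU, matrix_extend_mul_pow hI (hB𝔅 0) hUI hm]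
    exact matrix_extend_eq_of_pairedEntries (fun e he => hI _ (hEfst τ e he))
      (fun e he => snd_mem_of_mem_cyclicPairAlgebra hG₂ he)
      (fun e he => extend_eq_of_mem_cyclicPairAlgebra hAB hG₁ hGe he) (hUE.pow (by omega))
  -- Each `y ∈ 𝔄` has an operator model `ξ`, and a vanishing trace of `ξ* ξ` forces `ξ = 0`.
  · have hfaith : (∀ y ∈ 𝔄, ω.extend (star y * y) = 0) → ∀ y ∈ 𝔄, ω.extend y = 0 := by
      intro h y hy
      obtain ⟨ξ, hξ⟩ := exists_mem_pairAlgebra (x := x) (hrange ▸ hy)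
      have h1 := hGe _ (mul_mem (star_mem hξ) hξ)
      have h2 : operatorTrace (star ξ * ξ) = 0 := by
        rw [← hilbertTrace_extend (isTraceClassOperator_mul _ (hG₂ _ hξ))]
        exact h1.symm.trans (h y hy)
      have h3 := hGe _ hξ
      rw [eq_zero_of_operatorTrace_star_mul_self_eq_zero (hG₂ _ hξ) h2] at h3
      simpa using h3
    obtain ⟨σ, hσ, hσstar, hσpos⟩ := hAB.exists_positive hτ hfaith
    have hpair : ∀ p, IsExpectationPair σ G 𝔅 (A p) (X p) ∧
        IsExpectationPair σ G 𝔅 (star (A p)) (star (X p)) := fun p =>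
      ⟨fun N hN => (hAX p).mul_expectation hN, fun N hN => (hAX p).star.mul_expectation hN⟩
    have hPp := IsExpectationPair.list_prod_mul hσstar
      (C := fun p : Fin k => B p.castSucc.succ) (fun p => hB𝔅 _) (fun p => hpair p.castSucc)
      (hpair (Fin.last k)) (List.finRange k)
    have hPI := hPp.1.apply_mem hG₁
    have hPI' := hPp.2.apply_mem hG₁
    have hXdom : ∀ p i j, X p i j ∈ (hilbertTrace H).domain := fun p i j => hxdom _
    have hpdom : ∀ i j, (((List.finRange k).map fun p => X p.castSucc *
        ((B p.castSucc.succ).map σ).map (algebraMap ℂ (H →L[ℂ] H))).prod * X (Fin.last k)) i j ∈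
          (hilbertTrace H).domain :=
      list_prod_mul_mem ((hilbertTrace H).matrix (Fin n)).domain
        (fun p _ => (hilbertTrace H).mul_map_algebraMap_mem_matrix_domain (hXdom p.castSucc) _)
        (hXdom (Fin.last k))
    -- If there are at least two matrices `A p`, then `P = S * A (Fin.last k)` is itself a product
    -- of two matrices over the ideal. Otherwise the assumed commutation of `ω` with `𝔅` is applied
    -- entrywise.
    have hcomm : ∀ V W : Matrix (Fin n) (Fin n) 𝒜, (∀ i j, V i j ∈ 𝔅) → (∀ i j, W i j ∈ 𝔅) →
        (ω.matrix (Fin n)).extend (V * (P * W)) = (ω.matrix (Fin n)).extend (P * W * V) ∧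
        (ω.matrix (Fin n)).extend (V * (star P * W)) =
          (ω.matrix (Fin n)).extend (star P * W * V) := by
      intro V W hV hW
      rcases hcase with hk2 | hcase
      · have hSI' := hSI (by omega)
        constructor
        · rw [mul_assoc]
          exact matrix_extend_mul_mul_comm hI hV hSI' (matrix_mul_apply_mem _ fun i l j =>
            mul_mem_cyclicIdeal_right (hW l j) (hAI _ i l))
        · rw [star_mul, mul_assoc]
          exact matrix_extend_mul_mul_comm hI hV
            (fun i j => star_mem_cyclicIdeal (hAI _ j i)) (matrix_mul_apply_mem _ fun i l j =>
            mul_mem_cyclicIdeal_right (hW l j) (star_mem_cyclicIdeal (hSI' l i)))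
      · have hcase' : ∀ b ∈ 𝔅, ∀ y ∈ cyclicIdeal 𝔄 𝔅, ω.extend (b * y) = ω.extend (y * b) :=
          fun b hb y hy => by
            have h1 := hI _ (mul_mem_cyclicIdeal_left hb hy)
            have h2 := hI _ (mul_mem_cyclicIdeal_right hb hy)
            rw [ω.extend_apply h1, ω.extend_apply h2, hcase b hb y hy]
        exact ⟨matrix_extend_mul_comm_of_forall hI hcase' hV (matrix_mul_apply_mem _ fun i l j =>
            mul_mem_cyclicIdeal_right (hW l j) (hPI i l)),
          matrix_extend_mul_comm_of_forall hI hcase' hV (matrix_mul_apply_mem _ fun i l j =>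
            mul_mem_cyclicIdeal_right (hW l j) (hPI' i l))⟩
    obtain ⟨m, y, hydom, hy⟩ := exists_matrix_moments_eq hσ hG₁ hG₂ hGe hσstar hσpos (hB𝔅 0)
      (hB𝔅 (Fin.last (k + 1))) hpdom hPp hcomm
    have hYdom : ∀ i j, Y i j ∈ ω.domain := by
      rw [hYU]
      exact fun i j => hI _ (matrix_mul_apply_mem _
        (fun i l j => mul_mem_cyclicIdeal_left (hB𝔅 0 i l) (hUI l j)) i j)
    refine ⟨fun _ => hYdom, PiLp 2 (fun _ : Fin m => H), inferInstance, inferInstance,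
      inferInstance, inferInstance, fun _ => ⟨operatorMatrix y, operatorMatrix_mem_domain hydom⟩,
      sameDistribution_operatorMatrix (ω := ω.matrix (Fin n)) (a := fun _ : Unit => Y)
        (fun _ => hYdom)
        (M := fun _ : Unit => y) (fun _ => hydom) ?_⟩
    rw [hYP]
    exact hy
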